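/- Let $\nu$ be a $\sigma$-finite measure on a measurable space and let $f_0,f_1$ be probability densities with respect to $\nu$ whose Kullback--Leibler divergences $$I_0=\int \log\frac{f_0}{f_1}\,f_0\,d\nu,\qquad I_1=\int \log\frac{f_1}{f_0}\,f_1\,d\nu$$ are both positive and finite. For $i\in\{0,1\}$ let $\mathsf P_i$ (with expectation $\mathsf E_i$) be the law under which the observations $X_1,X_2,\dots$ are i.i.d. with density $f_i$, and set $\mathcal F_n=\sigma(X_1,\dots,X_n)$ and $\bar\Lambda_n=\frac1n\sum_{j=1}^n\log\frac{f_1(X_j)}{f_0(X_j)}$, $n\ge 1$. For $\alpha,\beta\in(0,1)$ let $\mathcal E(\alpha,\beta)$ be the class of pairs $(T,D)$ where $T$ is a stopping time of $(\mathcal F_n)_{n\ge1}$ with $T\ge 1$ that is finite almost surely under $\mathsf P_0$ and $\mathsf P_1$, $D$ is a $\{0,1\}$-valued random variable with $\{T=n,D=i\}\in\mathcal F_n$ for all $n\geq 1$, $i\in\{0,1\}$, and $\mathsf P_0(D=1)\le\alpha$, $\mathsf P_1(D=0)\le\beta$. Let $\mathcal L_i(\alpha,\beta)=\inf_{(T,D)\in\mathcal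 E(\alpha,\beta)}\mathsf E_i[T]$, and let $$n^*(\alpha,\beta)=\min\{n\ge1:\ \exists\,c\in\mathbb R,\ \mathsf P_0(\bar\Lambda_n>c)\le\alpha,\ \mathsf P_1(\bar\Lambda_n\le c)\le\beta\}.$$ Let $$\psi_0(c)=\sup_{\theta\ge0}\Big\{\theta c-\log\int f_1^{\theta}f_0^{1-\theta}\,d\nu\Big\},\qquad \psi_1(c)=\sup_{\theta\le0}\Big\{\theta c-\log\int f_0^{-\theta}f_1^{1+\theta}\,d\nu\Big\},$$ let $g^{-1}:(0,\infty)\to(-I_0,I_1)$ be the inverse of $g=\psi_0/\psi_1$ on $(-I_0,I_1)$, and set $h_i(\alpha,\beta)=\psi_i\big(g^{-1}(|\log\alpha|/|\log\beta|)\big)$ for $i\in\{0,1\}$. Let $(\alpha_k)$ and $(\beta_k)$ be sequences in $(0,1)$ that converge to $0$. (i) If $|\log\alpha_k|/|\log\beta_k|\to0$, then $h_1(\alpha_k,\beta_k)\to I_0$, $\ \mathcal L_1(\alpha_k,\beta_k)/n^*(\alpha_k,\beta_k)\to0$ and $n^*(\alpha_k,\beta_k)/\mathcal L_0(\alpha_k,\beta_k)\to1$.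 (ii) If $|\log\alpha_k|/|\log\beta_k|\to\infty$, then $h_0(\alpha_k,\beta_k)\to I_1$, $\ \mathcal L_0(\alpha_k,\beta_k)/n^*(\alpha_k,\beta_k)\to0$ and $n^*(\alpha_k,\beta_k)/\mathcal L_1(\alpha_k,\beta_k)\to1$. -/

import Mathlib

open MeasureTheory Filter Topology Set
open scoped ENNReal NNReal

noncomputable section

/-- A binary testing problem: a `σ`-finite reference measure `ν` and two probability densities
`f 0`, `f 1` (the null and the alternative hypothesis) with respect to `ν`. -/
structure BinaryTestingProblem (𝓧 : Type*) [MeasurableSpace 𝓧] where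
  ν : Measure 𝓧
  sigmaFinite : SigmaFinite ν
  f : Fin 2 → 𝓧 → ℝ≥0
  measurable_f : ∀ i, Measurable (f i)
  lintegral_f : ∀ i, ∫⁻ x, (f i x : ℝ≥0∞) ∂ν = 1

/-- The `σ`-algebra generated by the first `n` observations `X₁, …, Xₙ` of an infinite sequence;
`X_{j+1}` is the coordinate `ω ↦ ω j`. -/
abbrev obsSigma (𝓧 : Type*) [m : MeasurableSpace 𝓧] (n : ℕ) : MeasurableSpace (ℕ → 𝓧) :=
  ⨆ j : Fin n, MeasurableSpace.comap (fun ω : ℕ → 𝓧 => ω j) m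

/-- A pair `(T, D)` of a stopping time and a binary decision that depends only on the observations
collected up to time `T`. The value `T = ⊤` means that sampling never stops. -/
structure SequentialTest (𝓧 : Type*) [MeasurableSpace 𝓧] where
  T : (ℕ → 𝓧) → ℕ∞
  D : (ℕ → 𝓧) → Fin 2
  one_le_T : ∀ ω, 1 ≤ T ω
  measurableSet_T : ∀ n : ℕ, MeasurableSet[obsSigma 𝓧 n] {ω | T ω = (n : ℕ∞)}
  measurable_D : Measurable D
  measurableSet_D : ∀ (n : ℕ) (i : Fin 2),
    MeasurableSet[obsSigma 𝓧 n] {ω | T ω = (n : ℕ∞) ∧ D ω = i}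

namespace BinaryTestingProblem

variable {𝓧 : Type*} [MeasurableSpace 𝓧] (M : BinaryTestingProblem 𝓧)

/-- The law of one observation under hypothesis `i`. -/
def law (i : Fin 2) : Measure 𝓧 := M.ν.withDensity fun x => (M.f i x : ℝ≥0∞)

instance isProbabilityMeasure_law (i : Fin 2) : IsProbabilityMeasure (M.law i) :=
  ⟨by simp [law, M.lintegral_f i]⟩

/-- `P i`: the law of the i.i.d. sequence of observations under hypothesis `i`. -/
def P (i : Fin 2) : Measure (ℕ → 𝓧) := Measure.infinitePi fun _ : ℕ => M.law i

/-- The Kullback–Leibler divergence `I₀ = ∫ log (f₀ / f₁) f₀ dν`, with values in `[0, ∞]`. -/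
def I₀ : ℝ≥0∞ := InformationTheory.klDiv (M.law 0) (M.law 1)

/-- The Kullback–Leibler divergence `I₁ = ∫ log (f₁ / f₀) f₁ dν`, with values in `[0, ∞]`. -/
def I₁ : ℝ≥0∞ := InformationTheory.klDiv (M.law 1) (M.law 0)

/-- The log-likelihood ratio of the first `n` observations. (When the two divergences are finite,
both densities are positive at all observations almost surely under both hypotheses.) -/
def llrSum (n : ℕ) (ω : ℕ → 𝓧) : ℝ :=
  ∑ j ∈ Finset.range n, Real.log ((M.f 1 (ω j) : ℝ) / (M.f 0 (ω j) : ℝ))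

/-- The average log-likelihood ratio of the first `n` observations. -/
def avgLlr (n : ℕ) (ω : ℕ → 𝓧) : ℝ := M.llrSum n ω / n

/-- The class of tests that terminate almost surely under both hypotheses and whose
type-I and type-II error probabilities are at most `α` and `β`. -/
def testClass (α β : ℝ) : Set (SequentialTest 𝓧) :=
  {τ | (∀ i, ∀ᵐ ω ∂(M.P i), τ.T ω ≠ ⊤) ∧
    M.P 0 {ω | τ.D ω = 1} ≤ ENNReal.ofReal α ∧ M.P 1 {ω | τ.D ω = 0} ≤ ENNReal.ofReal β}

/-- The optimal expected sample size under hypothesis `i`. -/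
def optESS (i : Fin 2) (α β : ℝ) : ℝ≥0∞ :=
  ⨅ τ ∈ M.testClass α β, ∫⁻ ω, (τ.T ω : ℝ≥0∞) ∂(M.P i)

/-- The smallest sample size of a fixed-sample-size test with error probabilities at most
`α` and `β`. -/
def nStar (α β : ℝ) : ℕ :=
  sInf {n : ℕ | 1 ≤ n ∧ ∃ c : ℝ, M.P 0 {ω | c < M.avgLlr n ω} ≤ ENNReal.ofReal α ∧
    M.P 1 {ω | M.avgLlr n ω ≤ c} ≤ ENNReal.ofReal β}

/-- `ψ₀ c = sup_{θ ≥ 0} (θ c - log ∫ f₁^θ f₀^(1-θ) dν)`. -/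
def ψ₀ (c : ℝ) : EReal :=
  ⨆ (θ : ℝ) (_ : 0 ≤ θ), ((θ * c : ℝ) : EReal) -
    ENNReal.log (∫⁻ x, (M.f 1 x : ℝ≥0∞) ^ θ * (M.f 0 x : ℝ≥0∞) ^ (1 - θ) ∂M.ν)

/-- `ψ₁ c = sup_{θ ≤ 0} (θ c - log ∫ f₀^(-θ) f₁^(1+θ) dν)`, the Legendre transform of the
log-moment generating function of `log (f₁ / f₀)` under hypothesis `1`. -/
def ψ₁ (c : ℝ) : EReal :=
  ⨆ (θ : ℝ) (_ : θ ≤ 0), ((θ * c : ℝ) : EReal) -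
    ENNReal.log (∫⁻ x, (M.f 0 x : ℝ≥0∞) ^ (-θ) * (M.f 1 x : ℝ≥0∞) ^ (1 + θ) ∂M.ν)

/-- The ratio `ψ₀ / ψ₁`, used on the interval `(-I₀, I₁)`, where both are finite and positive. -/
def g (c : ℝ) : ℝ := (M.ψ₀ c).toReal / (M.ψ₁ c).toReal

/-- The inverse of `g : (-I₀, I₁) → (0, ∞)`. -/
def gInv (u : ℝ) : ℝ := Function.invFunOn M.g (Ioo (-M.I₀.toReal) M.I₁.toReal) u

/-- `h₀(α, β) = ψ₀ (g⁻¹ (|log α| / |log β|))`. -/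
def h₀ (α β : ℝ) : ℝ := (M.ψ₀ (M.gInv (|Real.log α| / |Real.log β|))).toReal

/-- `h₁(α, β) = ψ₁ (g⁻¹ (|log α| / |log β|))`. -/
def h₁ (α β : ℝ) : ℝ := (M.ψ₁ (M.gInv (|Real.log α| / |Real.log β|))).toReal

end BinaryTestingProblem

end

/-! ### The log-likelihood ratio of one observation and its moment generating function -/

namespace BinaryTestingProblem

variable {𝓧 : Type*} [MeasurableSpace 𝓧] (M : BinaryTestingProblem 𝓧)

/-! Finiteness of both divergences makes the two laws mutually absolutely continuous, and under
hypothesis `i` the log-likelihood ratio walk towards `j` has drift minus the divergence of `i` from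
`j`. In case (i) put `W = |log β| / I₀`, so that `|log α| = o(W)`. Three estimates suffice.

Lower bound (`eventually_le_lintegral_T`): a test that stops early and accepts the null moves, by
change of measure, a non-negligible part of `P 0` to `P 1` at a cost of at most `exp (m * (I₀ +
δ))`, the strong law bounding the walk up to time `m`. The type-II constraint then forces `E₀[T] ≥
(1 - η) W`.

Fixed-sample tests (`eventually_exists_sampleSize`): with about `W` observations and a threshold
just above `-I₀`, the type-II error is at most `β` by change of measure, while the type-I error is
exponentially small in `W`, hence below `α`. So `n* ≤ (1 + η) W`, and since fixed-sample tests are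
sequential tests, `n*` and the optimal `E₀[T]` are both asymptotic to `W`.

Crude upper bound (`exists_optESS_le`): the sequential probability ratio test gives `E₁[T] = O(|log
α| + 1) = o(W)`; no sharp constant is needed. Case (ii) exchanges the hypotheses.

The limits of `h₀` and `h₁` are separate and analytic. On `[-I₀, I₁]` one has `ψ₀ = Φ` and `ψ₁ = Φ -
c` for a single function `Φ` (`ψ₀_eq`, `ψ₁_eq`), which is monotone, vanishes at `-I₀` and is
positive to its right, with `Φ - c` bounded by `I₀` there. If `Φ / (Φ - c) → 0`, then `Φ → 0`, so `c
→ -I₀` and `Φ - c → I₀`. -/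

/-- The log-likelihood ratio `log (f j / f i)` of one observation. -/
noncomputable def logRatio (i j : Fin 2) (x : 𝓧) : ℝ :=
  Real.log ((M.f j x : ℝ) / (M.f i x : ℝ))

/-- The log-likelihood ratio of hypothesis `j` against hypothesis `i`
based on the first `n` observations. -/
noncomputable def logRatioSum (i j : Fin 2) (n : ℕ) (ω : ℕ → 𝓧) : ℝ :=
  ∑ k ∈ Finset.range n, M.logRatio i j (ω k)

/-- The moment generating function of `log (f j / f i)` under hypothesis `i`. -/
noncomputable def momentGen (i j : Fin 2) (s : ℝ) : ℝ≥0∞ :=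
  ∫⁻ x, ENNReal.ofReal (Real.exp (s * M.logRatio i j x)) ∂M.law i

lemma llrSum_eq (n : ℕ) (ω : ℕ → 𝓧) : M.llrSum n ω = M.logRatioSum 0 1 n ω := rfl

lemma logRatio_swap (i j : Fin 2) (x : 𝓧) : M.logRatio j i x = -M.logRatio i j x := by
  simp only [logRatio]
  rw [← Real.log_inv, inv_div]

lemma logRatioSum_swap (i j : Fin 2) (n : ℕ) (ω : ℕ → 𝓧) :
    M.logRatioSum j i n ω = -M.logRatioSum i j n ω := by
  simp only [logRatioSum, ← Finset.sum_neg_distrib, ← M.logRatio_swap i j]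

@[fun_prop]
lemma measurable_logRatio (i j : Fin 2) : Measurable (M.logRatio i j) := by
  have h0 := M.measurable_f i
  have h1 := M.measurable_f j
  unfold logRatio
  fun_prop

@[fun_prop]
lemma measurable_logRatioSum (i j : Fin 2) (n : ℕ) : Measurable (M.logRatioSum i j n) := by
  unfold logRatioSum
  fun_prop

lemma ae_law_iff {i : Fin 2} {p : 𝓧 → Prop} :
    (∀ᵐ x ∂M.law i, p x) ↔ ∀ᵐ x ∂M.ν, M.f i x ≠ 0 → p x := by
  rw [law, ae_withDensity_iff (M.measurable_f i).coe_nnreal_ennreal]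
  simp

lemma lintegral_law (i : Fin 2) {φ : 𝓧 → ℝ≥0∞} (hφ : Measurable φ) :
    ∫⁻ x, φ x ∂M.law i = ∫⁻ x, (M.f i x : ℝ≥0∞) * φ x ∂M.ν := by
  rw [law, lintegral_withDensity_eq_lintegral_mul _ (M.measurable_f i).coe_nnreal_ennreal hφ]
  rfl

variable {M} {i j : Fin 2}

/-- Applied in both directions, this makes the two densities vanish together off a `ν`-null set, so
the junk value of the logarithm matters only where both are zero. -/
lemma ae_imp_ne_zero (hij : M.law i ≪ M.law j) : ∀ᵐ x ∂M.ν, M.f i x ≠ 0 → M.f j x ≠ 0 :=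
  M.ae_law_iff.1 (hij.ae_le (M.ae_law_iff.2 (ae_of_all _ fun _ h => h)))

lemma exp_logRatio {x : 𝓧} (hi : M.f i x ≠ 0) (hj : M.f j x ≠ 0) :
    Real.exp (M.logRatio i j x) = M.f j x / M.f i x := by
  have h0 : (0 : ℝ) < M.f i x := by positivity
  have h1 : (0 : ℝ) < M.f j x := by positivity
  rw [logRatio, Real.exp_log (div_pos h1 h0)]

lemma mul_exp_logRatio {x : 𝓧} (hi : M.f i x ≠ 0) (hj : M.f j x ≠ 0) (s : ℝ) :
    (M.f i x : ℝ≥0∞) * ENNReal.ofReal (Real.exp (s * M.logRatio i j x)) =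
      (M.f j x : ℝ≥0∞) ^ s * (M.f i x : ℝ≥0∞) ^ (1 - s) := by
  have h0 : (0 : ℝ) < M.f i x := by positivity
  have h1 : (0 : ℝ) < M.f j x := by positivity
  rw [mul_comm s, Real.exp_mul, exp_logRatio hi hj, ← ENNReal.ofReal_coe_nnreal,
    ← ENNReal.ofReal_coe_nnreal, ENNReal.ofReal_rpow_of_pos h1, ENNReal.ofReal_rpow_of_pos h0,
    ← ENNReal.ofReal_mul h0.le, ← ENNReal.ofReal_mul (by positivity),
    Real.div_rpow h1.le h0.le, Real.rpow_sub h0, Real.rpow_one]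
  congr 1
  field_simp

lemma momentGen_eq (hij : M.law i ≪ M.law j) (hji : M.law j ≪ M.law i) (s : ℝ) :
    M.momentGen i j s = ∫⁻ x, (M.f j x : ℝ≥0∞) ^ s * (M.f i x : ℝ≥0∞) ^ (1 - s) ∂M.ν := by
  rw [momentGen, M.lintegral_law i (by fun_prop)]
  refine lintegral_congr_ae ?_
  filter_upwards [ae_imp_ne_zero hij, ae_imp_ne_zero hji] with x h1 h2
  by_cases hi : M.f i x = 0
  · have hj : M.f j x = 0 := by
      by_contra h
      exact h2 h hi
    simp only [hi, hj, ENNReal.coe_zero, zero_mul]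
    -- Here `0 ^ 0 = 1` and `0 ^ s = ∞` for `s < 0`; in each case the other factor is `0`, and `∞ *
    -- 0 = 0`.
    rcases lt_trichotomy s 0 with hs | hs | hs
    · rw [ENNReal.zero_rpow_of_pos (y := 1 - s) (by linarith), mul_zero]
    · simp [hs]
    · rw [ENNReal.zero_rpow_of_pos hs, zero_mul]
  · exact mul_exp_logRatio hi (h1 hi) s

/-- The symmetry through which estimates under one hypothesis yield estimates near `s = 1` for the
other. -/
lemma momentGen_swap (hij : M.law i ≪ M.law j) (hji : M.law j ≪ M.law i) (s : ℝ) :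
    M.momentGen j i s = M.momentGen i j (1 - s) := by
  rw [momentGen_eq hij hji, momentGen_eq hji hij]
  simp [mul_comm]

lemma withDensity_exp_logRatio (hij : M.law i ≪ M.law j) (hji : M.law j ≪ M.law i) :
    (M.law i).withDensity (fun x => ENNReal.ofReal (Real.exp (M.logRatio i j x))) = M.law j := by
  rw [law, ← withDensity_mul _ (M.measurable_f i).coe_nnreal_ennreal (by fun_prop), law]
  refine withDensity_congr_ae ?_
  filter_upwards [ae_imp_ne_zero hij, ae_imp_ne_zero hji] with x h1 h2
  by_cases hi : M.f i x = 0
  · have hj : M.f j x = 0 := by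
      by_contra h
      exact h2 h hi
    simp [hi, hj]
  · simpa using mul_exp_logRatio hi (h1 hi) 1

lemma momentGen_zero : M.momentGen i j 0 = 1 := by simp [momentGen]

lemma momentGen_one (hij : M.law i ≪ M.law j) (hji : M.law j ≪ M.law i) :
    M.momentGen i j 1 = 1 := by
  rw [← sub_zero (1 : ℝ), ← momentGen_swap hij hji, momentGen_zero]

lemma llr_law_ae_eq (hij : M.law i ≪ M.law j) (hji : M.law j ≪ M.law i) :
    llr (M.law i) (M.law j) =ᵐ[M.law i] M.logRatio j i := by
  have h := Measure.rnDeriv_withDensity (M.law j)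
    (f := fun x => ENNReal.ofReal (Real.exp (M.logRatio j i x))) (by fun_prop)
  rw [withDensity_exp_logRatio hji hij] at h
  filter_upwards [hij.ae_le h] with x hx
  rw [llr, hx, ENNReal.toReal_ofReal (Real.exp_nonneg _), Real.log_exp]

lemma integrable_logRatio (hij : M.law i ≪ M.law j) (hji : M.law j ≪ M.law i)
    (hK : InformationTheory.klDiv (M.law i) (M.law j) ≠ ∞) :
    Integrable (M.logRatio i j) (M.law i) := by
  have h := (InformationTheory.klDiv_ne_top_iff.1 hK).2
  rw [integrable_congr (llr_law_ae_eq hij hji)] at h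
  rw [show M.logRatio i j = -M.logRatio j i from funext fun x => M.logRatio_swap j i x]
  exact h.neg

lemma integral_logRatio (hij : M.law i ≪ M.law j) (hji : M.law j ≪ M.law i) :
    ∫ x, M.logRatio i j x ∂M.law i =
      -(InformationTheory.klDiv (M.law i) (M.law j)).toReal := by
  rw [InformationTheory.toReal_klDiv_of_measure_eq hij (by simp),
    integral_congr_ae (llr_law_ae_eq hij hji), ← integral_neg]
  simp [← M.logRatio_swap]

lemma ofReal_integral_le_lintegral_ofReal {μ : Measure 𝓧} {φ : 𝓧 → ℝ} (hφ : Integrable φ μ) :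
    ENNReal.ofReal (∫ x, φ x ∂μ) ≤ ∫⁻ x, ENNReal.ofReal (φ x) ∂μ := by
  rw [integral_eq_lintegral_pos_part_sub_lintegral_neg_part hφ]
  exact (ENNReal.ofReal_le_ofReal (sub_le_self _ ENNReal.toReal_nonneg)).trans
    ENNReal.ofReal_toReal_le

/-- Jensen's inequality for the moment generating function of the log-likelihood ratio. -/
lemma le_momentGen (hij : M.law i ≪ M.law j) (hji : M.law j ≪ M.law i)
    (hK : InformationTheory.klDiv (M.law i) (M.law j) ≠ ∞) (s : ℝ) :
    ENNReal.ofReal (Real.exp (-(s * (InformationTheory.klDiv (M.law i) (M.law j)).toReal))) ≤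
      M.momentGen i j s := by
  set K := (InformationTheory.klDiv (M.law i) (M.law j)).toReal with hKdef
  have hint := integrable_logRatio hij hji hK
  have h1 : Integrable (fun x => Real.exp (-(s * K)) * (1 + s * (M.logRatio i j x + K)))
      (M.law i) := by fun_prop
  -- The integrand is the tangent to `y ↦ exp (s * y)` at the mean `-K`, so its integral is its
  -- value there. The argument allows every real `s` and an infinite moment generating function.
  have h2 : ∫ x, Real.exp (-(s * K)) * (1 + s * (M.logRatio i j x + K)) ∂M.law i =
      Real.exp (-(s * K)) := by
    rw [integral_const_mul, integral_add (by fun_prop) (by fun_prop), integral_const_mul,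
      integral_add hint (by fun_prop), integral_logRatio hij hji]
    simp [hKdef]
  rw [← h2, momentGen]
  calc _ ≤ ∫⁻ x, ENNReal.ofReal (Real.exp (-(s * K)) * (1 + s * (M.logRatio i j x + K)))
        ∂M.law i := ofReal_integral_le_lintegral_ofReal h1
    _ ≤ _ := by
      refine lintegral_mono fun x => ENNReal.ofReal_le_ofReal ?_
      have := Real.add_one_le_exp (s * (M.logRatio i j x + K))
      calc _ ≤ Real.exp (-(s * K)) * Real.exp (s * (M.logRatio i j x + K)) := by
            gcongr
            linarith
        _ = _ := by
            rw [← Real.exp_add]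
            congr 1
            ring

/-- The chord of `exp` from `0` to `y`. It supplies an integrable majorant for `s ∈ [0, 1]`, because
`exp` of the log-likelihood ratio has mean `1`. -/
lemma exp_mul_le_convex {s : ℝ} (h0 : 0 ≤ s) (h1 : s ≤ 1) (y : ℝ) :
    Real.exp (s * y) ≤ (1 - s) + s * Real.exp y := by
  have := convexOn_exp.2 (mem_univ 0) (mem_univ y) (by linarith : 0 ≤ 1 - s) h0 (by ring)
  simpa using this

lemma integrable_exp_logRatio (hij : M.law i ≪ M.law j) (hji : M.law j ≪ M.law i) :
    Integrable (fun x => Real.exp (M.logRatio i j x)) (M.law i) := by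
  refine ⟨by fun_prop, ?_⟩
  rw [hasFiniteIntegral_iff_ofReal (ae_of_all _ fun _ => Real.exp_nonneg _)]
  have := momentGen_one hij hji
  simp only [momentGen, one_mul] at this
  rw [this]
  simp

lemma integral_exp_logRatio (hij : M.law i ≪ M.law j) (hji : M.law j ≪ M.law i) :
    ∫ x, Real.exp (M.logRatio i j x) ∂M.law i = 1 := by
  rw [integral_eq_lintegral_of_nonneg_ae (ae_of_all _ fun _ => Real.exp_nonneg _) (by fun_prop)]
  have := momentGen_one hij hji
  simp only [momentGen, one_mul] at this
  rw [this]
  simp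

lemma integrable_exp_mul_logRatio (hij : M.law i ≪ M.law j) (hji : M.law j ≪ M.law i)
    {s : ℝ} (h0 : 0 ≤ s) (h1 : s ≤ 1) :
    Integrable (fun x => Real.exp (s * M.logRatio i j x)) (M.law i) := by
  have := integrable_exp_logRatio hij hji
  refine Integrable.mono' (g := fun x => (1 - s) + s * Real.exp (M.logRatio i j x))
    (by fun_prop) (by fun_prop) (ae_of_all _ fun x => ?_)
  rw [Real.norm_of_nonneg (Real.exp_nonneg _)]
  exact exp_mul_le_convex h0 h1 _

lemma momentGen_eq_ofReal_integral (hij : M.law i ≪ M.law j) (hji : M.law j ≪ M.law i)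
    {s : ℝ} (h0 : 0 ≤ s) (h1 : s ≤ 1) :
    M.momentGen i j s = ENNReal.ofReal (∫ x, Real.exp (s * M.logRatio i j x) ∂M.law i) := by
  rw [ofReal_integral_eq_lintegral_ofReal (integrable_exp_mul_logRatio hij hji h0 h1)
    (ae_of_all _ fun _ => Real.exp_nonneg _), momentGen]

lemma momentGen_le_one (hij : M.law i ≪ M.law j) (hji : M.law j ≪ M.law i)
    {s : ℝ} (h0 : 0 ≤ s) (h1 : s ≤ 1) : M.momentGen i j s ≤ 1 := by
  rw [momentGen_eq_ofReal_integral hij hji h0 h1, ← ENNReal.ofReal_one]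
  refine ENNReal.ofReal_le_ofReal ?_
  have := integrable_exp_logRatio hij hji
  calc _ ≤ ∫ x, ((1 - s) + s * Real.exp (M.logRatio i j x)) ∂M.law i :=
        integral_mono (integrable_exp_mul_logRatio hij hji h0 h1) (by fun_prop)
          fun x => exp_mul_le_convex h0 h1 _
    _ = 1 := by
      rw [integral_add (by fun_prop) (by fun_prop), integral_const_mul,
        integral_exp_logRatio hij hji]
      simp

/-- The right derivative at `0` of the moment generating function is the mean, here in the form:
above the mean the Chernoff bound is nontrivial. -/
lemma exists_momentGen_lt (hij : M.law i ≪ M.law j) (hji : M.law j ≪ M.law i)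
    (hK : InformationTheory.klDiv (M.law i) (M.law j) ≠ ∞) {c : ℝ}
    (hc : -(InformationTheory.klDiv (M.law i) (M.law j)).toReal < c) :
    ∃ s ∈ Ioo (0 : ℝ) 1, M.momentGen i j s < ENNReal.ofReal (Real.exp (s * c)) := by
  set L := M.logRatio i j with hL
  have hint := integrable_logRatio hij hji hK
  have hexp := integrable_exp_logRatio hij hji
  have hlim : Tendsto (fun s : ℝ => ∫ x, (Real.exp (s * L x) - 1) / s ∂M.law i) (𝓝[>] 0)
      (𝓝 (∫ x, L x ∂M.law i)) := by
    -- The difference quotient lies between `L` (tangent at `0`) and `exp L - 1` (chord), which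
    -- gives the dominating function.
    refine tendsto_integral_filter_of_dominated_convergence
      (fun x => |L x| + (Real.exp (L x) + 1)) ?_ ?_ (by fun_prop) (ae_of_all _ fun x => ?_)
    · exact Eventually.of_forall fun s => by fun_prop
    · filter_upwards [Ioo_mem_nhdsGT (zero_lt_one (α := ℝ))] with s hs
      refine ae_of_all _ fun x => ?_
      have h1 := exp_mul_le_convex hs.1.le hs.2.le (L x)
      have h2 := Real.add_one_le_exp (s * L x)
      have h3 := Real.exp_pos (L x)
      rw [Real.norm_eq_abs, abs_le]
      constructor
      · rw [le_div_iff₀ hs.1]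
        nlinarith [neg_abs_le (L x), hs.1]
      · rw [div_le_iff₀ hs.1]
        nlinarith [abs_nonneg (L x), hs.1]
    · have h : HasDerivAt (fun s : ℝ => Real.exp (s * L x)) (L x) 0 := by
        have := ((hasDerivAt_id (0 : ℝ)).mul_const (L x)).exp
        simpa using this
      have h2 := h.tendsto_slope_zero_right
      simpa [div_eq_inv_mul] using h2
  rw [integral_logRatio hij hji] at hlim
  -- For small `s` the quotient is below `c`, so the moment generating function is below `1 + s * c
  -- ≤ exp (s * c)`.
  obtain ⟨s, hs, hs'⟩ := ((hlim.eventually (gt_mem_nhds hc)).and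
    (Ioo_mem_nhdsGT (zero_lt_one (α := ℝ)))).exists
  refine ⟨s, hs', ?_⟩
  rw [momentGen_eq_ofReal_integral hij hji hs'.1.le hs'.2.le]
  refine (ENNReal.ofReal_lt_ofReal_iff (Real.exp_pos _)).2 ?_
  have hi := integrable_exp_mul_logRatio hij hji hs'.1.le hs'.2.le
  rw [integral_div, integral_sub hi (by fun_prop), div_lt_iff₀ hs'.1] at hs
  have := Real.add_one_le_exp (s * c)
  simp only [integral_const, probReal_univ, smul_eq_mul, mul_one] at hs
  linarith

end BinaryTestingProblem

/-! ### Log-likelihood sums: change of measure, Chernoff bounds, strong law -/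

namespace BinaryTestingProblem

variable {𝓧 : Type*} [MeasurableSpace 𝓧] {M : BinaryTestingProblem 𝓧} {i j : Fin 2}

instance isProbabilityMeasure_P (i : Fin 2) : IsProbabilityMeasure (M.P i) := by
  unfold P
  infer_instance

lemma obsSigma_le (n : ℕ) : obsSigma 𝓧 n ≤ MeasurableSpace.pi :=
  iSup_le fun k => (measurable_pi_apply (k : ℕ)).comap_le

lemma exists_preimage_of_obsSigma {n : ℕ} {A : Set (ℕ → 𝓧)} (hA : MeasurableSet[obsSigma 𝓧 n] A) :
    ∃ B : Set (Fin n → 𝓧), MeasurableSet B ∧ A = (fun ω (k : Fin n) => ω k) ⁻¹' B := by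
  have h : obsSigma 𝓧 n =
      MeasurableSpace.comap (fun (ω : ℕ → 𝓧) (k : Fin n) => ω k) MeasurableSpace.pi := by
    simp only [obsSigma, MeasurableSpace.pi, MeasurableSpace.comap_iSup,
      MeasurableSpace.comap_comp]
    rfl
  rw [h] at hA
  obtain ⟨B, hB, rfl⟩ := hA
  exact ⟨B, hB, rfl⟩

lemma measurable_obsSigma_logRatioSum (i j : Fin 2) {m n : ℕ} (h : m ≤ n) :
    Measurable[obsSigma 𝓧 n] (M.logRatioSum i j m) := by
  unfold logRatioSum
  refine Finset.measurable_sum _ fun k hk => ?_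
  refine (M.measurable_logRatio i j).comp ?_
  have hkn : k < n := (Finset.mem_range.1 hk).trans_le h
  exact Measurable.mono (comap_measurable _) (le_iSup
    (fun k : Fin n => MeasurableSpace.comap (fun ω : ℕ → 𝓧 => ω k) ‹MeasurableSpace 𝓧›)
    ⟨k, hkn⟩) le_rfl

lemma lintegral_prod_P (i : Fin 2) (n : ℕ) (φ : ℕ → 𝓧 → ℝ≥0∞) (hφ : ∀ k, Measurable (φ k)) :
    ∫⁻ ω, ∏ k ∈ Finset.range n, φ k (ω k) ∂M.P i =
      ∏ k ∈ Finset.range n, ∫⁻ x, φ k x ∂M.law i := by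
  have hind : ProbabilityTheory.iIndepFun (fun k (ω : ℕ → 𝓧) => φ k (ω k)) (M.P i) :=
    ProbabilityTheory.iIndepFun_infinitePi hφ
  rw [ProbabilityTheory.lintegral_prod_eq_prod_lintegral_of_indepFun _ _ hind fun k =>
    (hφ k).comp (measurable_pi_apply k)]
  refine Finset.prod_congr rfl fun k _ => ?_
  rw [← Measure.infinitePi_map_eval (fun _ : ℕ => M.law i) k,
    lintegral_map (hφ k) (measurable_pi_apply k)]
  rfl

lemma ofReal_exp_mul_logRatioSum (s : ℝ) (n : ℕ) (ω : ℕ → 𝓧) :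
    ENNReal.ofReal (Real.exp (s * M.logRatioSum i j n ω)) =
      ∏ k ∈ Finset.range n, ENNReal.ofReal (Real.exp (s * M.logRatio i j (ω k))) := by
  rw [logRatioSum, Finset.mul_sum, Real.exp_sum,
    ENNReal.ofReal_prod_of_nonneg fun _ _ => Real.exp_nonneg _]

lemma lintegral_exp_mul_logRatioSum (s : ℝ) (n : ℕ) :
    ∫⁻ ω, ENNReal.ofReal (Real.exp (s * M.logRatioSum i j n ω)) ∂M.P i =
      M.momentGen i j s ^ n := by
  simp only [ofReal_exp_mul_logRatioSum]
  rw [lintegral_prod_P i n (fun _ x => ENNReal.ofReal (Real.exp (s * M.logRatio i j x)))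
    fun k => by fun_prop]
  simp [momentGen]

/-- The likelihood ratio of the first `n` observations is the density of `P j` with respect to
`P i` on the `σ`-algebra generated by these observations. -/
lemma P_apply_eq_setLIntegral (hij : M.law i ≪ M.law j) (hji : M.law j ≪ M.law i) {n : ℕ}
    {A : Set (ℕ → 𝓧)} (hA : MeasurableSet[obsSigma 𝓧 n] A) :
    M.P j A = ∫⁻ ω in A, ENNReal.ofReal (Real.exp (M.logRatioSum i j n ω)) ∂M.P i := by
  have hproj : Measurable fun (ω : ℕ → 𝓧) (k : Fin n) => ω k := by fun_prop
  -- An event of `obsSigma` is a preimage under projection to the first `n` coordinates, where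
  -- measures are determined by rectangles; below, `t` extends a rectangle by `univ` in the later
  -- coordinates.
  have key : ((M.P i).withDensity
      fun ω => ENNReal.ofReal (Real.exp (M.logRatioSum i j n ω))).map
        (fun ω (k : Fin n) => ω k) = (M.P j).map (fun ω (k : Fin n) => ω k) := by
    have h1 : Measure.pi (fun _ : Fin n => M.law j) = (M.P j).map (fun ω (k : Fin n) => ω k) := by
      refine Measure.pi_eq fun s hs => ?_
      rw [Measure.map_apply hproj (MeasurableSet.univ_pi hs)]
      let t : ℕ → Set 𝓧 := fun k => if h : k < n then s ⟨k, h⟩ else univ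
      have ht : ∀ k : Fin n, t k = s k := fun k => by simp [t]
      have : (fun (ω : ℕ → 𝓧) (k : Fin n) => ω k) ⁻¹' univ.pi s =
          Set.pi (Finset.range n : Set ℕ) t := by
        ext ω
        simp only [mem_preimage, Set.mem_pi, Finset.coe_range, mem_Iio]
        exact ⟨fun h k hk => by simpa [t, hk] using h ⟨k, hk⟩,
          fun h k => by simpa [ht] using h k k.2⟩
      rw [this, P, Measure.infinitePi_pi _ fun k hk => ?_, Finset.prod_range]
      · simp [ht]
      · have hk' : k < n := Finset.mem_range.1 hk
        simpa [t, hk'] using hs _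
    rw [← h1]
    refine (Measure.pi_eq fun s hs => ?_).symm
    rw [Measure.map_apply hproj (MeasurableSet.univ_pi hs),
      withDensity_apply _ (hproj (MeasurableSet.univ_pi hs)),
      ← lintegral_indicator (hproj (MeasurableSet.univ_pi hs))]
    let t : ℕ → Set 𝓧 := fun k => if h : k < n then s ⟨k, h⟩ else univ
    have ht : ∀ k : Fin n, t k = s k := fun k => by simp [t]
    have htm : ∀ k, MeasurableSet (t k) := fun k => by
      by_cases h : k < n
      · simpa [t, h] using hs _
      · simp [t, h]
    have h2 := lintegral_prod_P (M := M) i n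
      (fun k => (t k).indicator fun x => ENNReal.ofReal (Real.exp (M.logRatio i j x)))
      (fun k => Measurable.indicator (by fun_prop) (htm k))
    have h3 : ∀ k : ℕ, ∫⁻ x, (t k).indicator
        (fun x => ENNReal.ofReal (Real.exp (M.logRatio i j x))) x ∂M.law i = M.law j (t k) := by
      intro k
      rw [lintegral_indicator (htm k), ← withDensity_apply _ (htm k),
        withDensity_exp_logRatio hij hji]
    simp only [h3] at h2
    rw [Finset.prod_range] at h2
    simp only [ht] at h2
    rw [← h2]
    refine lintegral_congr fun ω => ?_
    by_cases hω : ∀ k : Fin n, ω k ∈ s k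
    · rw [indicator_of_mem (by simpa using hω), ← one_mul (M.logRatioSum i j n ω),
        ofReal_exp_mul_logRatioSum]
      refine Finset.prod_congr rfl fun k hk => ?_
      have hk' : k < n := Finset.mem_range.1 hk
      rw [indicator_of_mem, one_mul]
      simpa [t, hk'] using hω ⟨k, hk'⟩
    · rw [indicator_of_notMem (by simpa using hω)]
      push Not at hω
      obtain ⟨k, hk⟩ := hω
      refine (Finset.prod_eq_zero (Finset.mem_range.2 k.2) ?_).symm
      rw [indicator_of_notMem]
      rwa [ht]
  obtain ⟨B, hB, rfl⟩ := exists_preimage_of_obsSigma hA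
  have h := congrArg (fun μ => μ B) key
  simp only [Measure.map_apply hproj hB, withDensity_apply _ (hproj hB)] at h
  exact h.symm

/-- The density is at most `exp b` on `A`. This inequality drives both the lower bound for
sequential tests and the error control of the tests constructed below. -/
lemma P_le_exp_mul (hij : M.law i ≪ M.law j) (hji : M.law j ≪ M.law i) {n : ℕ}
    {A : Set (ℕ → 𝓧)} (hA : MeasurableSet[obsSigma 𝓧 n] A) {b : ℝ}
    (hb : ∀ ω ∈ A, M.logRatioSum i j n ω ≤ b) :
    M.P j A ≤ ENNReal.ofReal (Real.exp b) * M.P i A := by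
  rw [P_apply_eq_setLIntegral hij hji hA, ← setLIntegral_const]
  exact setLIntegral_mono measurable_const fun ω hω =>
    ENNReal.ofReal_le_ofReal (Real.exp_le_exp.2 (hb ω hω))

/-- Chernoff's bound for the upper tail of the log-likelihood ratio. -/
lemma P_le_logRatioSum (i j : Fin 2) {s : ℝ} (hs : 0 ≤ s) (n : ℕ) (b : ℝ) :
    M.P i {ω | b ≤ M.logRatioSum i j n ω} ≤
      ENNReal.ofReal (Real.exp (-(s * b))) * M.momentGen i j s ^ n := by
  have h1 : {ω | b ≤ M.logRatioSum i j n ω} ⊆ {ω | (1 : ℝ≥0∞) ≤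
      ENNReal.ofReal (Real.exp (-(s * b))) *
        ENNReal.ofReal (Real.exp (s * M.logRatioSum i j n ω))} := by
    intro ω hω
    simp only [mem_ofPred] at hω ⊢
    rw [← ENNReal.ofReal_mul (Real.exp_nonneg _), ← Real.exp_add, ← ENNReal.ofReal_one]
    refine ENNReal.ofReal_le_ofReal (Real.one_le_exp ?_)
    nlinarith
  refine (measure_mono h1).trans ?_
  have h2 := mul_meas_ge_le_lintegral (μ := M.P i) (f := fun ω =>
    ENNReal.ofReal (Real.exp (-(s * b))) *
      ENNReal.ofReal (Real.exp (s * M.logRatioSum i j n ω))) (by fun_prop) 1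
  rwa [one_mul, lintegral_const_mul _ (by fun_prop), lintegral_exp_mul_logRatioSum] at h2

lemma P_logRatioSum_le (hij : M.law i ≪ M.law j) (hji : M.law j ≪ M.law i) (n : ℕ) (b : ℝ) :
    M.P j {ω | M.logRatioSum i j n ω ≤ b} ≤ ENNReal.ofReal (Real.exp b) := by
  have hm : MeasurableSet[obsSigma 𝓧 n] {ω | M.logRatioSum i j n ω ≤ b} :=
    measurable_obsSigma_logRatioSum i j le_rfl measurableSet_Iic
  refine (P_le_exp_mul hij hji hm fun _ h => h).trans ?_
  exact mul_le_of_le_one_right' prob_le_one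

lemma ae_tendsto_logRatioSum (hij : M.law i ≪ M.law j) (hji : M.law j ≪ M.law i)
    (hK : InformationTheory.klDiv (M.law i) (M.law j) ≠ ∞) :
    ∀ᵐ ω ∂M.P i, Tendsto (fun n : ℕ => M.logRatioSum i j n ω / n) atTop
      (𝓝 (-(InformationTheory.klDiv (M.law i) (M.law j)).toReal)) := by
  have hmap : ∀ k : ℕ, (M.P i).map (fun ω => ω k) = M.law i :=
    Measure.infinitePi_map_eval (fun _ : ℕ => M.law i)
  have hint := integrable_logRatio hij hji hK
  have h := ProbabilityTheory.strong_law_ae_real (μ := M.P i)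
    (fun k ω => M.logRatio i j (ω k)) ?_ ?_ ?_
  · have hmean : ∫ ω, M.logRatio i j (ω 0) ∂M.P i =
        -(InformationTheory.klDiv (M.law i) (M.law j)).toReal := by
      rw [← integral_logRatio hij hji, ← hmap 0,
        integral_map (measurable_pi_apply 0).aemeasurable (by fun_prop)]
    rw [hmean] at h
    exact h
  · rw [← hmap 0] at hint
    exact hint.comp_measurable (measurable_pi_apply 0)
  · intro k l hkl
    exact (ProbabilityTheory.iIndepFun_infinitePi (P := fun _ : ℕ => M.law i)
      (X := fun _ => M.logRatio i j) fun _ => by fun_prop).indepFun hkl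
  · intro k
    have hmeas := fun k : ℕ => ((M.measurable_logRatio i j).comp
      (measurable_pi_apply (X := fun _ : ℕ => 𝓧) k)).aemeasurable (μ := M.P i)
    refine ⟨hmeas k, hmeas 0, ?_⟩
    have := fun k => Measure.map_map (μ := M.P i) (M.measurable_logRatio i j)
      (measurable_pi_apply (X := fun _ : ℕ => 𝓧) k)
    simp only [Function.comp_def] at this
    rw [← this, ← this]
    congr 1
    exact (hmap k).trans (hmap 0).symm

/-- Beyond some `N` the terms obey `u n ≤ n * (K + δ)`; the finitely many earlier ones are bounded
by a constant, which `m * (K + δ)` eventually exceeds. -/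
lemma eventually_forall_le_mul {u : ℕ → ℝ} {K δ : ℝ} (hK : 0 ≤ K) (hδ : 0 < δ)
    (hu : Tendsto (fun n : ℕ => u n / n) atTop (𝓝 K)) (hu0 : u 0 = 0) :
    ∀ᶠ m : ℕ in atTop, ∀ n ≤ m, u n ≤ m * (K + δ) := by
  obtain ⟨N, hN⟩ := eventually_atTop.1 (hu.eventually (gt_mem_nhds (by linarith : K < K + δ)))
  obtain ⟨C, hC⟩ := ((Finset.range N).image u).bddAbove
  have hlarge : ∀ᶠ m : ℕ in atTop, C ≤ m * (K + δ) :=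
    (tendsto_natCast_atTop_atTop.atTop_mul_const (by linarith : 0 < K + δ)).eventually_ge_atTop C
  filter_upwards [hlarge] with m hm n hn
  rcases lt_or_ge n N with h | h
  · exact (hC (by simpa using ⟨n, h, rfl⟩)).trans hm
  -- The quotient `u 0 / 0` is `0` by default and says nothing about `u 0`.
  · rcases Nat.eq_zero_or_pos n with rfl | hpos
    · rw [hu0]
      positivity
    · have hn' : (0 : ℝ) < n := by exact_mod_cast hpos
      have h1 := (div_lt_iff₀ hn').1 (hN n h)
      have h2 : (n : ℝ) ≤ m := by exact_mod_cast hn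
      nlinarith

/-- By the strong law, the maximum of the first `m` log-likelihood ratios is eventually at most
`m (K + δ)`, with probability tending to `1`. -/
lemma tendsto_P_exists_lt (hij : M.law i ≪ M.law j) (hji : M.law j ≪ M.law i)
    (hK : InformationTheory.klDiv (M.law i) (M.law j) ≠ ∞) {δ : ℝ} (hδ : 0 < δ) :
    Tendsto (fun m : ℕ => M.P i {ω | ∃ n ≤ m,
      m * ((InformationTheory.klDiv (M.law i) (M.law j)).toReal + δ) < M.logRatioSum j i n ω})
      atTop (𝓝 0) := by
  have h := tendsto_measure_of_ae_tendsto_indicator (μ := M.P i) (L := atTop) (A := ∅)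
    (As := fun m : ℕ => {ω | ∃ n ≤ m,
      m * ((InformationTheory.klDiv (M.law i) (M.law j)).toReal + δ) < M.logRatioSum j i n ω})
    MeasurableSet.empty (fun m => ?_) (B := univ) MeasurableSet.univ (by simp) (by simp) ?_
  · simpa using h
  · have : {ω | ∃ n ≤ m, m * ((InformationTheory.klDiv (M.law i) (M.law j)).toReal + δ) <
        M.logRatioSum j i n ω} = ⋃ n ∈ Finset.range (m + 1),
        {ω | m * ((InformationTheory.klDiv (M.law i) (M.law j)).toReal + δ) <
          M.logRatioSum j i n ω} := by
      ext ω
      simp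
    rw [this]
    exact Finset.measurableSet_biUnion _ fun n _ => measurableSet_lt (by fun_prop) (by fun_prop)
  · filter_upwards [ae_tendsto_logRatioSum hij hji hK] with ω hω
    have hω' : Tendsto (fun n : ℕ => M.logRatioSum j i n ω / n) atTop
        (𝓝 (InformationTheory.klDiv (M.law i) (M.law j)).toReal) := by
      simpa [M.logRatioSum_swap i j, neg_div] using hω.neg
    filter_upwards [eventually_forall_le_mul ENNReal.toReal_nonneg hδ hω'
      (by simp [logRatioSum])] with m hm
    simpa using hm

end BinaryTestingProblem

/-! ### Expected sample sizes: tail sums and the change-of-measure lower bound -/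

namespace SequentialTest

variable {𝓧 : Type*} [MeasurableSpace 𝓧]

lemma measurable_T (τ : SequentialTest 𝓧) : Measurable fun ω => (τ.T ω : ℝ≥0∞) := by
  have h : ∀ n : ℕ, MeasurableSet {ω | τ.T ω = n} := fun n =>
    BinaryTestingProblem.obsSigma_le n _ (τ.measurableSet_T n)
  have h' : Measurable τ.T := by
    refine measurable_to_countable' fun t => ?_
    induction t with
    | top =>
      have : τ.T ⁻¹' {⊤} = (⋃ n : ℕ, {ω | τ.T ω = n})ᶜ := by
        ext ω
        simp only [mem_preimage, mem_singleton_iff, mem_compl_iff, mem_iUnion, mem_ofPred,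
          not_exists]
        constructor
        · intro h n
          simp [h]
        · intro h
          by_contra h'
          obtain ⟨n, hn⟩ := ENat.ne_top_iff_exists.1 h'
          exact h n hn.symm
      rw [this]
      exact (MeasurableSet.iUnion h).compl
    | coe n => exact h n
  exact (measurable_of_countable _).comp h'

end SequentialTest

namespace BinaryTestingProblem

variable {𝓧 : Type*} [MeasurableSpace 𝓧] {M : BinaryTestingProblem 𝓧} {i j : Fin 2}

lemma lintegral_coe_enat_eq_tsum {Ω : Type*} [MeasurableSpace Ω] (μ : Measure Ω) {T : Ω → ℕ∞}
    (hT : Measurable fun ω => (T ω : ℝ≥0∞)) :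
    ∫⁻ ω, (T ω : ℝ≥0∞) ∂μ = ∑' n : ℕ, μ {ω | (n : ℕ∞) < T ω} := by
  have hm : ∀ n : ℕ, MeasurableSet {ω | (n : ℕ∞) < T ω} := fun n => by
    have : {ω | (n : ℕ∞) < T ω} = {ω | (n : ℝ≥0∞) < T ω} := by
      ext ω
      simp only [mem_ofPred]
      rw [← ENat.toENNReal_coe n, ENat.toENNReal_lt]
    rw [this]
    exact measurableSet_lt measurable_const hT
  have hpt : ∀ t : ℕ∞, (t : ℝ≥0∞) = ∑' n : ℕ, if (n : ℕ∞) < t then 1 else 0 := by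
    intro t
    induction t with
    | top => simp
    | coe k =>
      rw [tsum_eq_sum (s := Finset.range k) (by simp)]
      simp [Finset.filter_true_of_mem]
  calc ∫⁻ ω, (T ω : ℝ≥0∞) ∂μ
      = ∫⁻ ω, ∑' n : ℕ, {ω | (n : ℕ∞) < T ω}.indicator 1 ω ∂μ := by
        refine lintegral_congr fun ω => ?_
        rw [hpt]
        simp [indicator_apply]
    _ = ∑' n : ℕ, μ {ω | (n : ℕ∞) < T ω} := by
        rw [lintegral_tsum fun n => (measurable_one.indicator (hm n)).aemeasurable]
        exact tsum_congr fun n => lintegral_indicator_one (hm n)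

/-- Terms before `⌈B / r⌉` are bounded by `1`, later ones by a geometric series. The result is
affine in `B`. -/
lemma tsum_le_of_exponential_tail {p : ℕ → ℝ≥0∞} (hp : ∀ n, p n ≤ 1) {B r : ℝ}
    (hB : 0 ≤ B) (hr : 0 < r) (h : ∀ n : ℕ, p n ≤ ENNReal.ofReal (Real.exp (B - r * n))) :
    ∑' n, p n ≤ ENNReal.ofReal (B / r + 1 + (1 - Real.exp (-r))⁻¹) := by
  have hq : Real.exp (-r) < 1 := by simpa using hr
  have hq0 := Real.exp_nonneg (-r)
  obtain ⟨N, hNle, hNlt⟩ : ∃ N : ℕ, B / r ≤ N ∧ (N : ℝ) < B / r + 1 :=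
    ⟨_, Nat.le_ceil _, Nat.ceil_lt_add_one (by positivity)⟩
  have hhead : ∑ n ∈ Finset.range N, p n ≤ ENNReal.ofReal (B / r + 1) :=
    calc ∑ n ∈ Finset.range N, p n ≤ ∑ n ∈ Finset.range N, 1 := Finset.sum_le_sum fun n _ => hp n
      _ = ENNReal.ofReal N := by simp
      _ ≤ _ := ENNReal.ofReal_le_ofReal hNlt.le
  have htail : ∑' n, p (n + N) ≤ ENNReal.ofReal (1 - Real.exp (-r))⁻¹ :=
    calc ∑' n, p (n + N) ≤ ∑' n : ℕ, ENNReal.ofReal (Real.exp (-r) ^ n) := by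
          refine ENNReal.tsum_le_tsum fun n => (h _).trans (ENNReal.ofReal_le_ofReal ?_)
          rw [← Real.exp_nat_mul]
          refine Real.exp_le_exp.2 ?_
          rw [div_le_iff₀ hr] at hNle
          push_cast
          nlinarith
      _ = ENNReal.ofReal (1 - Real.exp (-r))⁻¹ := by
          rw [← ENNReal.ofReal_tsum_of_nonneg (fun n => pow_nonneg hq0 n)
            (summable_geometric_of_lt_one hq0 hq), tsum_geometric_of_lt_one hq0 hq]
  have hpos : 0 ≤ (1 - Real.exp (-r))⁻¹ := inv_nonneg.2 (by linarith)
  have hpos' : 0 ≤ B / r + 1 := by positivity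
  calc ∑' n, p n = ∑ n ∈ Finset.range N, p n + ∑' n, p (n + N) :=
        (Summable.sum_add_tsum_nat_add' (f := p) (k := N) ENNReal.summable).symm
    _ ≤ ENNReal.ofReal (B / r + 1) + ENNReal.ofReal (1 - Real.exp (-r))⁻¹ :=
        add_le_add hhead htail
    _ = _ := (ENNReal.ofReal_add hpos' hpos).symm

/-- Lower bound for the expected sample size of a sequential test by change of measure. -/
lemma le_lintegral_T (hij : M.law i ≪ M.law j) (hji : M.law j ≪ M.law i) (hne : i ≠ j)
    (τ : SequentialTest 𝓧) (m : ℕ) (b : ℝ) :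
    (m : ℝ≥0∞) * (1 - (M.P i {ω | τ.D ω = j} +
      ENNReal.ofReal (Real.exp b) * M.P j {ω | τ.D ω = i} +
      M.P i {ω | ∃ n ≤ m, b < M.logRatioSum j i n ω})) ≤ ∫⁻ ω, (τ.T ω : ℝ≥0∞) ∂M.P i := by
  set A : ℕ → Set (ℕ → 𝓧) := fun n => {ω | (τ.T ω = n ∧ τ.D ω = i) ∧ M.logRatioSum j i n ω ≤ b}
  have hA : ∀ n, MeasurableSet[obsSigma 𝓧 n] (A n) := fun n =>
    MeasurableSet.inter (τ.measurableSet_D n i)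
      (measurable_obsSigma_logRatioSum j i le_rfl measurableSet_Iic)
  have hAP : ∀ n, M.P i (A n) ≤ ENNReal.ofReal (Real.exp b) * M.P j (A n) := fun n =>
    P_le_exp_mul hji hij (hA n) fun ω hω => hω.2
  have hsum : M.P i (⋃ n ∈ Finset.range (m + 1), A n) ≤
      ENNReal.ofReal (Real.exp b) * M.P j {ω | τ.D ω = i} := by
    calc M.P i (⋃ n ∈ Finset.range (m + 1), A n)
        ≤ ∑ n ∈ Finset.range (m + 1), M.P i (A n) := measure_biUnion_finset_le _ _
      _ ≤ ∑ n ∈ Finset.range (m + 1), ENNReal.ofReal (Real.exp b) * M.P j (A n) :=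
          Finset.sum_le_sum fun n _ => hAP n
      _ = ENNReal.ofReal (Real.exp b) * M.P j (⋃ n ∈ Finset.range (m + 1), A n) := by
          rw [← Finset.mul_sum, measure_biUnion_finset]
          · intro n _ n' _ hnn'
            refine Set.disjoint_left.2 fun ω h h' => hnn' ?_
            have := h.1.1.symm.trans h'.1.1
            exact_mod_cast this
          · exact fun n _ => obsSigma_le n _ (hA n)
      _ ≤ _ := by
          gcongr
          exact iUnion₂_subset fun n _ ω hω => hω.1.2
  -- If `T < m`, then the decision is `j`, or it is `i` with the walk at most `b` at the stopping
  -- time, or the walk has exceeded `b` by time `m`. Markov's inequality then turns a lower bound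
  -- for `P i (T ≥ m)` into one for the mean.
  have hsub : {ω | (m : ℝ≥0∞) ≤ τ.T ω}ᶜ ⊆ {ω | τ.D ω = j} ∪ (⋃ n ∈ Finset.range (m + 1), A n) ∪
      {ω | ∃ n ≤ m, b < M.logRatioSum j i n ω} := by
    intro ω hω
    simp only [mem_compl_iff, mem_ofPred, not_le] at hω
    rw [← ENat.toENNReal_coe m, ENat.toENNReal_lt] at hω
    obtain ⟨n, hn⟩ := ENat.ne_top_iff_exists.1 hω.ne_top
    rw [← hn] at hω
    have hnm : n < m := by exact_mod_cast hω
    by_cases hD : τ.D ω = j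
    · exact Or.inl (Or.inl hD)
    have hD' : τ.D ω = i := by omega
    by_cases hS : M.logRatioSum j i n ω ≤ b
    · refine Or.inl (Or.inr ?_)
      simp only [mem_iUnion, Finset.mem_range]
      exact ⟨n, by omega, ⟨hn.symm, hD'⟩, hS⟩
    · exact Or.inr ⟨n, hnm.le, not_le.1 hS⟩
  refine le_trans ?_ (mul_meas_ge_le_lintegral τ.measurable_T (m : ℝ≥0∞))
  gcongr
  rw [tsub_le_iff_right]
  calc (1 : ℝ≥0∞) = M.P i univ := measure_univ.symm
    _ = M.P i ({ω | (m : ℝ≥0∞) ≤ τ.T ω} ∪ {ω | (m : ℝ≥0∞) ≤ τ.T ω}ᶜ) := by rw [union_compl_self]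
    _ ≤ M.P i {ω | (m : ℝ≥0∞) ≤ τ.T ω} + M.P i {ω | (m : ℝ≥0∞) ≤ τ.T ω}ᶜ := measure_union_le _ _
    _ ≤ _ := by
      gcongr
      refine (measure_mono hsub).trans ((measure_union_le _ _).trans ?_)
      gcongr
      refine (measure_union_le _ _).trans ?_
      gcongr

/-! ### The sequential probability ratio test and upper bounds for the optimal sample sizes -/

/-- The stopping rule of the sequential probability ratio test with boundaries `-b` and `a`. -/
def StopsAt (M : BinaryTestingProblem 𝓧) (a b : ℝ) (n : ℕ) (ω : ℕ → 𝓧) : Prop :=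
  1 ≤ n ∧ (a ≤ M.logRatioSum 0 1 n ω ∨ M.logRatioSum 0 1 n ω ≤ -b)

open Classical in
/-- The sample size of the sequential probability ratio test with boundaries `-b` and `a`. -/
noncomputable def sprtTime (M : BinaryTestingProblem 𝓧) (a b : ℝ) (ω : ℕ → 𝓧) : ℕ∞ :=
  if h : ∃ n, M.StopsAt a b n ω then (Nat.find h : ℕ∞) else ⊤

lemma sprtTime_eq_coe_iff {a b : ℝ} {n : ℕ} {ω : ℕ → 𝓧} :
    M.sprtTime a b ω = n ↔ M.StopsAt a b n ω ∧ ∀ m < n, ¬ M.StopsAt a b m ω := by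
  classical
  unfold sprtTime
  split_ifs with h
  · rw [Nat.cast_inj, Nat.find_eq_iff]
  · simp only [ENat.top_ne_natCast, false_iff, not_and]
    exact fun h' => absurd ⟨n, h'⟩ h

lemma not_stopsAt_of_lt_sprtTime {a b : ℝ} {n : ℕ} {ω : ℕ → 𝓧} (h : (n : ℕ∞) < M.sprtTime a b ω) :
    ¬ M.StopsAt a b n ω := by
  classical
  unfold sprtTime at h
  split_ifs at h with h'
  · exact Nat.find_min h' (by exact_mod_cast h)
  · exact fun h'' => h' ⟨n, h''⟩

lemma measurableSet_stopsAt (a b : ℝ) {m n : ℕ} (h : m ≤ n) :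
    MeasurableSet[obsSigma 𝓧 n] {ω | M.StopsAt a b m ω} := by
  have h1 : MeasurableSet[obsSigma 𝓧 n] {ω | a ≤ M.logRatioSum 0 1 m ω} :=
    measurable_obsSigma_logRatioSum 0 1 h measurableSet_Ici
  have h2 : MeasurableSet[obsSigma 𝓧 n] {ω | M.logRatioSum 0 1 m ω ≤ -b} :=
    measurable_obsSigma_logRatioSum 0 1 h measurableSet_Iic
  exact MeasurableSet.inter (MeasurableSet.const _) (h1.union h2)

lemma measurableSet_sprtTime_eq (a b : ℝ) (n : ℕ) :
    MeasurableSet[obsSigma 𝓧 n] {ω | M.sprtTime a b ω = n} := by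
  have : {ω | M.sprtTime a b ω = n} =
      {ω | M.StopsAt a b n ω} ∩ ⋂ m ∈ Finset.range n, {ω | M.StopsAt a b m ω}ᶜ := by
    ext ω
    simp [sprtTime_eq_coe_iff]
  rw [this]
  refine (measurableSet_stopsAt a b le_rfl).inter (Finset.measurableSet_biInter _ fun m hm => ?_)
  exact (measurableSet_stopsAt a b (Finset.mem_range.1 hm).le).compl

open Classical in
/-- The sequential probability ratio test with boundaries `-b` and `a`. -/
noncomputable def sprt (M : BinaryTestingProblem 𝓧) (a b : ℝ) : SequentialTest 𝓧 where
  T := M.sprtTime a b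
  D ω := if ∃ n : ℕ, M.sprtTime a b ω = n ∧ a ≤ M.logRatioSum 0 1 n ω then 1 else 0
  one_le_T ω := by
    unfold sprtTime
    split_ifs with h
    · exact_mod_cast (Nat.find_spec h).1
    · exact le_top
  measurableSet_T := measurableSet_sprtTime_eq a b
  measurable_D := by
    refine Measurable.ite ?_ measurable_const measurable_const
    have : {ω | ∃ n : ℕ, M.sprtTime a b ω = n ∧ a ≤ M.logRatioSum 0 1 n ω} =
        ⋃ n : ℕ, {ω | M.sprtTime a b ω = n} ∩ {ω | a ≤ M.logRatioSum 0 1 n ω} := by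
      ext ω
      simp
    rw [this]
    exact MeasurableSet.iUnion fun n => (obsSigma_le n _ (measurableSet_sprtTime_eq a b n)).inter
      (measurableSet_le (by fun_prop) (by fun_prop))
  measurableSet_D n i := by
    have h1 : MeasurableSet[obsSigma 𝓧 n] {ω | a ≤ M.logRatioSum 0 1 n ω} :=
      measurable_obsSigma_logRatioSum 0 1 le_rfl measurableSet_Ici
    have h2 : ∀ ω, M.sprtTime a b ω = n →
        ((∃ n : ℕ, M.sprtTime a b ω = n ∧ a ≤ M.logRatioSum 0 1 n ω) ↔
          a ≤ M.logRatioSum 0 1 n ω) := by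
      intro ω hω
      simp [hω]
    rcases Fin.exists_fin_two.1 ⟨i, rfl⟩ with rfl | rfl
    · convert! (measurableSet_sprtTime_eq (M := M) a b n).inter h1.compl using 1
      ext ω
      simp only [mem_ofPred, mem_inter_iff, mem_compl_iff]
      refine and_congr_right fun hω => ?_
      rw [if_congr (h2 ω hω) rfl rfl]
      split_ifs with h <;> simp [h]
    · convert! (measurableSet_sprtTime_eq (M := M) a b n).inter h1 using 1
      ext ω
      simp only [mem_ofPred, mem_inter_iff]
      refine and_congr_right fun hω => ?_
      rw [if_congr (h2 ω hω) rfl rfl]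
      split_ifs with h <;> simp [h]

/-- If the log-likelihood ratio is at most `b` on the `n`-th member of a sequence of disjoint
events, observable up to time `n`, then their union has probability at most `exp b`. -/
lemma P_iUnion_le (hij : M.law i ≪ M.law j) (hji : M.law j ≪ M.law i) {A : ℕ → Set (ℕ → 𝓧)}
    (hA : ∀ n, MeasurableSet[obsSigma 𝓧 n] (A n)) (hd : Pairwise (Function.onFun Disjoint A)) {b : ℝ}
    (hb : ∀ n, ∀ ω ∈ A n, M.logRatioSum i j n ω ≤ b) :
    M.P j (⋃ n, A n) ≤ ENNReal.ofReal (Real.exp b) := by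
  calc M.P j (⋃ n, A n) ≤ ∑' n, M.P j (A n) := measure_iUnion_le _
    _ ≤ ∑' n, ENNReal.ofReal (Real.exp b) * M.P i (A n) :=
        ENNReal.tsum_le_tsum fun n => P_le_exp_mul hij hji (hA n) (hb n)
    _ = ENNReal.ofReal (Real.exp b) * M.P i (⋃ n, A n) := by
        rw [ENNReal.tsum_mul_left, measure_iUnion hd fun n => obsSigma_le n _ (hA n)]
    _ ≤ _ := mul_le_of_le_one_right' prob_le_one

/-- Chernoff's bound is nontrivial at a level `c'` strictly between the mean and `c`; the gap gives
the rate `r = s * (c - c')`, and shifting by `b` costs `exp (s * b)`. -/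
lemma exists_exponential_bound (hij : M.law i ≪ M.law j) (hji : M.law j ≪ M.law i)
    (hK : InformationTheory.klDiv (M.law i) (M.law j) ≠ ∞) {c : ℝ}
    (hc : -(InformationTheory.klDiv (M.law i) (M.law j)).toReal < c) :
    ∃ s r : ℝ, 0 < s ∧ 0 < r ∧ ∀ (n : ℕ) (b : ℝ), M.P i {ω | n * c - b ≤ M.logRatioSum i j n ω} ≤
      ENNReal.ofReal (Real.exp (s * b - r * n)) := by
  obtain ⟨c', hc', hc'c⟩ := exists_between hc
  obtain ⟨s, hs, hlt⟩ := exists_momentGen_lt hij hji hK hc'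
  refine ⟨s, s * (c - c'), hs.1, mul_pos hs.1 (by linarith), fun n b => ?_⟩
  refine (P_le_logRatioSum i j hs.1.le n _).trans ?_
  calc _ ≤ ENNReal.ofReal (Real.exp (-(s * (n * c - b)))) *
        ENNReal.ofReal (Real.exp (s * c')) ^ n := by gcongr
    _ = _ := by
      rw [← ENNReal.ofReal_pow (Real.exp_nonneg _), ← ENNReal.ofReal_mul (Real.exp_nonneg _),
        ← Real.exp_nat_mul, ← Real.exp_add]
      congr 2
      ring

lemma lt_sprtTime_subset {a b : ℝ} (hb : 0 ≤ b) (n : ℕ) :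
    {ω | (n : ℕ∞) < M.sprtTime a b ω} ⊆ {ω | -b ≤ M.logRatioSum 0 1 n ω} := by
  intro ω hω
  have h := not_stopsAt_of_lt_sprtTime hω
  rcases Nat.eq_zero_or_pos n with rfl | hn
  · simpa [logRatioSum] using hb
  · simp only [StopsAt, not_and, not_or, not_le] at h
    exact (h hn).2.le

lemma lt_sprtTime_subset' {a b : ℝ} (ha : 0 ≤ a) (n : ℕ) :
    {ω | (n : ℕ∞) < M.sprtTime a b ω} ⊆ {ω | -a ≤ M.logRatioSum 1 0 n ω} := by
  intro ω hω
  have h := not_stopsAt_of_lt_sprtTime hω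
  rcases Nat.eq_zero_or_pos n with rfl | hn
  · simpa [logRatioSum] using ha
  · simp only [StopsAt, not_and, not_or, not_le] at h
    simpa [M.logRatioSum_swap 0 1] using (h hn).1.le

/-- A rate for the expected sample size of the sequential probability ratio test. -/
lemma exists_lintegral_le (hij : M.law i ≪ M.law j) (hji : M.law j ≪ M.law i)
    (hK : InformationTheory.klDiv (M.law i) (M.law j) ≠ ∞)
    (hK0 : InformationTheory.klDiv (M.law i) (M.law j) ≠ 0) :
    ∃ C : ℝ, 0 ≤ C ∧ ∀ (B : ℝ) (τ : SequentialTest 𝓧), 0 ≤ B →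
      (∀ n : ℕ, {ω | (n : ℕ∞) < τ.T ω} ⊆ {ω | -B ≤ M.logRatioSum i j n ω}) →
      ∫⁻ ω, (τ.T ω : ℝ≥0∞) ∂M.P i ≤ ENNReal.ofReal (C * (B + 1)) := by
  -- The drift is negative, so level `c = 0` is admissible and the event `-B ≤ S` is the case `b =
  -- B`.
  obtain ⟨s, r, hs, hr, h⟩ := exists_exponential_bound hij hji hK
    (neg_lt_zero.2 (ENNReal.toReal_pos hK0 hK))
  have hq : 0 < (1 - Real.exp (-r))⁻¹ := by
    have : Real.exp (-r) < 1 := by simpa using hr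
    exact inv_pos.2 (by linarith)
  refine ⟨s / r + 1 + (1 - Real.exp (-r))⁻¹, by positivity, fun B τ hB hτ => ?_⟩
  rw [lintegral_coe_enat_eq_tsum _ τ.measurable_T]
  refine (tsum_le_of_exponential_tail (fun n => prob_le_one) (B := s * B) (r := r)
    (by positivity) hr fun n => ?_).trans (ENNReal.ofReal_le_ofReal ?_)
  · have := h n B
    simp only [mul_zero, zero_sub] at this
    exact (measure_mono (hτ n)).trans this
  · have h1 : s * B / r = s / r * B := by ring
    have h2 : 0 < s / r := by positivity
    rw [h1]
    nlinarith

lemma ae_ne_top_of_lintegral_ne_top {τ : SequentialTest 𝓧}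
    (h : ∫⁻ ω, (τ.T ω : ℝ≥0∞) ∂M.P i ≠ ∞) : ∀ᵐ ω ∂M.P i, τ.T ω ≠ ⊤ := by
  filter_upwards [ae_lt_top τ.measurable_T h] with ω hω h'
  simp [h'] at hω

lemma disjoint_sprtTime_eq (a b : ℝ) (B : ℕ → Set (ℕ → 𝓧)) :
    Pairwise (Function.onFun Disjoint fun n : ℕ => {ω | M.sprtTime a b ω = n} ∩ B n) := by
  intro n m hnm
  refine Set.disjoint_left.2 fun ω h h' => hnm ?_
  have := h.1.symm.trans h'.1
  exact_mod_cast this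

/-- Wald's boundaries `|log α|` and `|log β|` bound the likelihood ratio at stopping, hence the
errors. Under each hypothesis the tail of `T` is controlled by the boundary towards which the walk
drifts, with a constant independent of `α` and `β`. -/
lemma exists_optESS_le (h01 : M.law 0 ≪ M.law 1) (h10 : M.law 1 ≪ M.law 0)
    (hK0 : M.I₀ ≠ ∞) (hK0' : M.I₀ ≠ 0) (hK1 : M.I₁ ≠ ∞) (hK1' : M.I₁ ≠ 0) :
    ∃ C : ℝ, 0 ≤ C ∧ ∀ α β : ℝ, α ∈ Ioo (0 : ℝ) 1 → β ∈ Ioo (0 : ℝ) 1 →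
      M.optESS 0 α β ≤ ENNReal.ofReal (C * (|Real.log β| + 1)) ∧
      M.optESS 1 α β ≤ ENNReal.ofReal (C * (|Real.log α| + 1)) := by
  obtain ⟨C0, hC0, h0⟩ := exists_lintegral_le h01 h10 hK0 hK0'
  obtain ⟨C1, hC1, h1⟩ := exists_lintegral_le h10 h01 hK1 hK1'
  refine ⟨max C0 C1, hC0.trans (le_max_left _ _), fun α β hα hβ => ?_⟩
  have ha := abs_of_neg (Real.log_neg hα.1 hα.2)
  have hb := abs_of_neg (Real.log_neg hβ.1 hβ.2)
  set τ := M.sprt |Real.log α| |Real.log β| with hτ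
  have hE0 := h0 |Real.log β| τ (abs_nonneg _) (lt_sprtTime_subset (abs_nonneg _))
  have hE1 := h1 |Real.log α| τ (abs_nonneg _) (lt_sprtTime_subset' (abs_nonneg _))
  have hfin : ∀ i, ∀ᵐ ω ∂M.P i, τ.T ω ≠ ⊤ := by
    intro i
    rcases Fin.exists_fin_two.1 ⟨i, rfl⟩ with rfl | rfl
    · exact ae_ne_top_of_lintegral_ne_top (hE0.trans_lt ENNReal.ofReal_lt_top).ne
    · exact ae_ne_top_of_lintegral_ne_top (hE1.trans_lt ENNReal.ofReal_lt_top).ne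
  have hmem : τ ∈ M.testClass α β := by
    refine ⟨hfin, ?_, ?_⟩
    · have := P_iUnion_le h10 h01 (A := fun n : ℕ =>
        {ω | M.sprtTime |Real.log α| |Real.log β| ω = n} ∩
          {ω | |Real.log α| ≤ M.logRatioSum 0 1 n ω})
        (fun n => (measurableSet_sprtTime_eq _ _ n).inter
          (measurable_obsSigma_logRatioSum 0 1 le_rfl measurableSet_Ici))
        (disjoint_sprtTime_eq _ _ _) (b := Real.log α) (fun n ω hω => ?_)
      · rw [Real.exp_log hα.1] at this
        refine (measure_mono ?_).trans this
        intro ω hω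
        simp only [hτ, sprt, mem_ofPred, ite_eq_left_iff, zero_ne_one, imp_false, not_not] at hω
        simpa using hω
      · have := hω.2
        simp only [mem_ofPred] at this
        rw [M.logRatioSum_swap 0 1]
        linarith
    · have := P_iUnion_le h01 h10 (A := fun n : ℕ =>
        {ω | M.sprtTime |Real.log α| |Real.log β| ω = n} ∩
          {ω | M.logRatioSum 0 1 n ω ≤ -|Real.log β|})
        (fun n => (measurableSet_sprtTime_eq _ _ n).inter
          (measurable_obsSigma_logRatioSum 0 1 le_rfl measurableSet_Iic))
        (disjoint_sprtTime_eq _ _ _) (b := Real.log β) (fun n ω hω => ?_)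
      · rw [Real.exp_log hβ.1] at this
        -- The decision is also `0` when sampling never stops, so almost sure termination is needed
        -- here.
        refine (measure_mono_ae ?_).trans this
        filter_upwards [hfin 1] with ω hω hD
        obtain ⟨n, hn⟩ := ENat.ne_top_iff_exists.1 hω
        have hn' : M.sprtTime |Real.log α| |Real.log β| ω = n := hn.symm
        simp only [hτ, sprt] at hD
        simp only [ite_eq_right_iff, one_ne_zero, imp_false, not_exists, not_and] at hD
        refine mem_iUnion.2 ⟨n, hn', ?_⟩
        exact (sprtTime_eq_coe_iff.1 hn').1.2.resolve_left (hD n hn')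
      · have := hω.2
        simp only [mem_ofPred] at this
        linarith
  constructor
  · refine (iInf₂_le τ hmem).trans (hE0.trans (ENNReal.ofReal_le_ofReal ?_))
    gcongr
    exact le_max_left _ _
  · refine (iInf₂_le τ hmem).trans (hE1.trans (ENNReal.ofReal_le_ofReal ?_))
    gcongr
    exact le_max_right _ _

end BinaryTestingProblem

/-! ### Asymptotics of the optimal sample sizes -/

namespace BinaryTestingProblem

variable {𝓧 : Type*} [MeasurableSpace 𝓧] {M : BinaryTestingProblem 𝓧} {i j : Fin 2}

lemma tendsto_abs_log_atTop {b : ℕ → ℝ} (hb0 : ∀ k, b k ∈ Ioo (0 : ℝ) 1)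
    (hb : Tendsto b atTop (𝓝 0)) : Tendsto (fun k => |Real.log (b k)|) atTop atTop := by
  refine tendsto_abs_atBot_atTop.comp (Real.tendsto_log_nhdsGT_zero.comp ?_)
  exact tendsto_nhdsWithin_iff.2 ⟨hb, Eventually.of_forall fun k => (hb0 k).1⟩

/-- The asymptotic lower bound for the expected sample size under hypothesis `i`. -/
lemma eventually_le_lintegral_T (hij : M.law i ≪ M.law j) (hji : M.law j ≪ M.law i) (hne : i ≠ j)
    (hK : InformationTheory.klDiv (M.law i) (M.law j) ≠ ∞)
    (hK0 : InformationTheory.klDiv (M.law i) (M.law j) ≠ 0) {a b : ℕ → ℝ}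
    (ha : Tendsto a atTop (𝓝 0)) (hb0 : ∀ k, b k ∈ Ioo (0 : ℝ) 1) (hb : Tendsto b atTop (𝓝 0))
    {η : ℝ} (hη : η ∈ Ioo (0 : ℝ) 1) :
    ∀ᶠ k in atTop, ∀ τ : SequentialTest 𝓧, M.P i {ω | τ.D ω = j} ≤ ENNReal.ofReal (a k) →
      M.P j {ω | τ.D ω = i} ≤ ENNReal.ofReal (b k) →
      ENNReal.ofReal ((1 - η) * (|Real.log (b k)| /
        (InformationTheory.klDiv (M.law i) (M.law j)).toReal)) ≤
          ∫⁻ ω, (τ.T ω : ℝ≥0∞) ∂M.P i := by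
  have hp := tendsto_P_exists_lt hij hji hK (δ := (InformationTheory.klDiv (M.law i)
    (M.law j)).toReal * (η / 4)) (mul_pos (ENNReal.toReal_pos hK0 hK) (by linarith [hη.1]))
  have hKpos := ENNReal.toReal_pos hK0 hK
  set K := (InformationTheory.klDiv (M.law i) (M.law j)).toReal
  obtain ⟨hη0, hη1⟩ := hη
  have hB := tendsto_abs_log_atTop hb0 hb
  -- With `m` the floor of this quantity and walk bound `m * (K + K * η / 4)`, the inequality `(1 -
  -- η / 2) * (1 + η / 4) ≤ 1 - η / 4` makes the change-of-measure term at most `exp (-(η / 4) *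
  -- |log b|)`.
  have hW : Tendsto (fun k => (1 - η / 2) * (|Real.log (b k)| / K)) atTop atTop :=
    (hB.atTop_div_const hKpos).const_mul_atTop (by linarith)
  have hm := tendsto_nat_floor_atTop.comp hW
  have hsmall : Tendsto (fun k => ENNReal.ofReal (a k) +
      ENNReal.ofReal (Real.exp (-(η / 4 * |Real.log (b k)|))) +
      M.P i {ω | ∃ n ≤ ⌊(1 - η / 2) * (|Real.log (b k)| / K)⌋₊,
        (⌊(1 - η / 2) * (|Real.log (b k)| / K)⌋₊ : ℝ) * (K + K * (η / 4)) <
          M.logRatioSum j i n ω}) atTop (𝓝 0) := by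
    have h1 := ENNReal.tendsto_ofReal ha
    have h2 := ENNReal.tendsto_ofReal (Real.tendsto_exp_neg_atTop_nhds_zero.comp
      (hB.const_mul_atTop (by linarith : 0 < η / 4)))
    have h3 := hp.comp hm
    simp only [ENNReal.ofReal_zero] at h1 h2
    simpa using (h1.add h2).add h3
  have hη4 : (0 : ℝ≥0∞) < ENNReal.ofReal (η / 4) := ENNReal.ofReal_pos.2 (by linarith)
  -- The second condition says `1 ≤ (η / 4) * |log b| / K`, which absorbs the loss from the floor.
  filter_upwards [hsmall.eventually (gt_mem_nhds hη4), hB.eventually_ge_atTop (4 * K / η)]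
    with k hk hBk τ hτ1 hτ2
  set m := ⌊(1 - η / 2) * (|Real.log (b k)| / K)⌋₊
  have hlog := abs_of_neg (Real.log_neg (hb0 k).1 (hb0 k).2)
  have hWk : 0 ≤ (1 - η / 2) * (|Real.log (b k)| / K) :=
    mul_nonneg (by linarith) (div_nonneg (abs_nonneg _) hKpos.le)
  have hm1 : (m : ℝ) ≤ (1 - η / 2) * (|Real.log (b k)| / K) := Nat.floor_le hWk
  have hm2 : (1 - η / 2) * (|Real.log (b k)| / K) < m + 1 := Nat.lt_floor_add_one _
  refine le_trans ?_ (le_lintegral_T hij hji hne τ m (m * (K + K * (η / 4))))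
  have hexp : ENNReal.ofReal (Real.exp (m * (K + K * (η / 4)))) * ENNReal.ofReal (b k) ≤
      ENNReal.ofReal (Real.exp (-(η / 4 * |Real.log (b k)|))) := by
    rw [← ENNReal.ofReal_mul (Real.exp_nonneg _)]
    refine ENNReal.ofReal_le_ofReal ?_
    calc _ = Real.exp (m * (K + K * (η / 4)) + Real.log (b k)) := by
          rw [Real.exp_add, Real.exp_log (hb0 k).1]
      _ ≤ _ := by
          refine Real.exp_le_exp.2 ?_
          have h1 : (m : ℝ) * (K + K * (η / 4)) ≤
              (1 - η / 2) * (|Real.log (b k)| / K) * (K + K * (η / 4)) := by gcongr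
          have h2 : (1 - η / 2) * (|Real.log (b k)| / K) * (K + K * (η / 4)) =
              (1 - η / 2) * (1 + η / 4) * |Real.log (b k)| := by field_simp
          have h3 : (1 - η / 2) * (1 + η / 4) * |Real.log (b k)| ≤
              (1 - η / 4) * |Real.log (b k)| := by
            gcongr
            nlinarith
          rw [h2] at h1
          linarith
  have hle : M.P i {ω | τ.D ω = j} + ENNReal.ofReal (Real.exp (m * (K + K * (η / 4)))) *
      M.P j {ω | τ.D ω = i} + M.P i {ω | ∃ n ≤ m, m * (K + K * (η / 4)) <
        M.logRatioSum j i n ω} ≤ ENNReal.ofReal (η / 4) := by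
    refine le_trans ?_ hk.le
    gcongr
    exact (mul_le_mul_right hτ2 _).trans hexp
  calc _ ≤ ENNReal.ofReal (m * (1 - η / 4)) := by
        refine ENNReal.ofReal_le_ofReal ?_
        have h1 : 1 ≤ η / 4 * (|Real.log (b k)| / K) := by
          rw [div_le_iff₀ hη0] at hBk
          rw [← mul_div_assoc, le_div_iff₀ hKpos]
          linarith
        have h2 : (1 - 3 * η / 4) * (|Real.log (b k)| / K) ≤ m := by linarith
        have h3 : 0 ≤ |Real.log (b k)| / K := by positivity
        calc (1 - η) * (|Real.log (b k)| / K)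
            ≤ (1 - 3 * η / 4) * (1 - η / 4) * (|Real.log (b k)| / K) := by
              gcongr
              nlinarith
          _ = (1 - 3 * η / 4) * (|Real.log (b k)| / K) * (1 - η / 4) := by ring
          _ ≤ _ := by
              gcongr
              linarith
    _ = (m : ℝ≥0∞) * (1 - ENNReal.ofReal (η / 4)) := by
        rw [ENNReal.ofReal_mul (by positivity), ENNReal.ofReal_natCast,
          ENNReal.ofReal_sub _ (by linarith), ENNReal.ofReal_one]
    _ ≤ _ := by gcongr

/-- Fixed-sample-size tests whose sample size is asymptotically `|log b| / K` when the other error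
level is subexponential in this sample size. -/
lemma eventually_exists_sampleSize (hij : M.law i ≪ M.law j) (hji : M.law j ≪ M.law i)
    (hK : InformationTheory.klDiv (M.law i) (M.law j) ≠ ∞)
    (hK0 : InformationTheory.klDiv (M.law i) (M.law j) ≠ 0) {a b : ℕ → ℝ}
    (ha0 : ∀ k, a k ∈ Ioo (0 : ℝ) 1) (hb0 : ∀ k, b k ∈ Ioo (0 : ℝ) 1)
    (hb : Tendsto b atTop (𝓝 0))
    (hab : Tendsto (fun k => |Real.log (a k)| / |Real.log (b k)|) atTop (𝓝 0))
    {η : ℝ} (hη : 0 < η) :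
    ∃ c : ℝ, ∀ᶠ k in atTop, ∃ n : ℕ, 1 ≤ n ∧ (n : ℝ) ≤ (1 + η) * (|Real.log (b k)| /
        (InformationTheory.klDiv (M.law i) (M.law j)).toReal) ∧
      M.P i {ω | n * c ≤ M.logRatioSum i j n ω} ≤ ENNReal.ofReal (a k) ∧
      M.P j {ω | M.logRatioSum i j n ω ≤ n * c} ≤ ENNReal.ofReal (b k) := by
  have hKpos := ENNReal.toReal_pos hK0 hK
  have hbound := fun c => exists_exponential_bound hij hji hK (c := c)
  set K := (InformationTheory.klDiv (M.law i) (M.law j)).toReal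
  have hη2 : 0 < 1 + η / 2 := by linarith
  -- The threshold lies just above the mean `-K`, so the error under `i` is at most `exp (-r * n)`;
  -- and `n = ⌈(1 + η / 2) * W⌉` still gives `n * K / (1 + η / 2) ≥ |log b|`, which handles the
  -- error under `j`.
  obtain ⟨s, r, hs, hr, h⟩ := hbound (-(K / (1 + η / 2))) (by
    rw [neg_lt_neg_iff, div_lt_iff₀ hη2]
    nlinarith)
  have hB := tendsto_abs_log_atTop hb0 hb
  refine ⟨-(K / (1 + η / 2)), ?_⟩
  -- The first condition absorbs the rounding up in `n`; the second says `|log a| < r * W`, hence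
  -- `exp (-r * n) ≤ a`.
  filter_upwards [hB.eventually_ge_atTop (2 * K / η),
    hab.eventually (gt_mem_nhds (div_pos hr hKpos))] with k hBk hrk
  have hloga := abs_of_neg (Real.log_neg (ha0 k).1 (ha0 k).2)
  have hlogb := abs_of_neg (Real.log_neg (hb0 k).1 (hb0 k).2)
  have hBpos : 0 < |Real.log (b k)| := abs_pos.2 (Real.log_neg (hb0 k).1 (hb0 k).2).ne
  set W := |Real.log (b k)| / K with hW
  have hWpos : 0 < W := div_pos hBpos hKpos
  have hWK : |Real.log (b k)| = W * K := by
    rw [hW]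
    field_simp
  have hn1 : (1 + η / 2) * W ≤ ⌈(1 + η / 2) * W⌉₊ := Nat.le_ceil _
  have hn2 : (⌈(1 + η / 2) * W⌉₊ : ℝ) < (1 + η / 2) * W + 1 :=
    Nat.ceil_lt_add_one (by positivity)
  set n := ⌈(1 + η / 2) * W⌉₊
  have h1 : 1 ≤ η / 2 * W := by
    rw [div_le_iff₀ hη] at hBk
    rw [hW, ← mul_div_assoc, le_div_iff₀ hKpos]
    linarith
  refine ⟨n, Nat.ceil_pos.2 (by positivity), by linarith, ?_, ?_⟩
  · have h2 := h n 0
    simp only [sub_zero, mul_zero, zero_sub] at h2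
    refine h2.trans (ENNReal.ofReal_le_ofReal ?_)
    rw [← Real.le_log_iff_exp_le (ha0 k).1]
    rw [div_lt_iff₀ hBpos, hWK] at hrk
    have h3 : r / K * (W * K) = r * W := by field_simp
    have h4 : W ≤ n := by nlinarith
    nlinarith
  · refine (P_logRatioSum_le hij hji n _).trans (ENNReal.ofReal_le_ofReal ?_)
    rw [← Real.le_log_iff_exp_le (hb0 k).1]
    have h3 : W ≤ n / (1 + η / 2) := by
      rw [le_div_iff₀ hη2]
      linarith
    have h4 : W * K ≤ n / (1 + η / 2) * K := by gcongr
    have h5 : (n : ℝ) * -(K / (1 + η / 2)) = -(n / (1 + η / 2) * K) := by ring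
    linarith

open Classical in
/-- The test with fixed sample size `n` that rejects when the average log-likelihood ratio
exceeds `c`. -/
noncomputable def fixedSampleSizeTest (M : BinaryTestingProblem 𝓧) (n : ℕ) (hn : 1 ≤ n) (c : ℝ) :
    SequentialTest 𝓧 where
  T _ := n
  D ω := if c < M.avgLlr n ω then 1 else 0
  one_le_T _ := by exact_mod_cast hn
  measurableSet_T _ := MeasurableSet.const _
  measurable_D := Measurable.ite (measurableSet_lt measurable_const
    ((M.measurable_logRatioSum 0 1 n).div_const _)) measurable_const measurable_const
  measurableSet_D m i := by
    by_cases hm : n = m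
    · subst hm
      have h := (measurable_obsSigma_logRatioSum (M := M) 0 1 (le_refl n)).div_const (n : ℝ)
      have h' : Measurable[obsSigma 𝓧 n]
          fun ω => if c < M.avgLlr n ω then (1 : Fin 2) else 0 :=
        Measurable.ite (h measurableSet_Ioi) measurable_const measurable_const
      convert! h' (measurableSet_singleton i) using 1
      ext ω
      simp
    · simp [hm]

lemma optESS_le_of_mem (i : Fin 2) {α β : ℝ} {n : ℕ}
    (hn : n ∈ {n : ℕ | 1 ≤ n ∧ ∃ c : ℝ, M.P 0 {ω | c < M.avgLlr n ω} ≤ ENNReal.ofReal α ∧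
      M.P 1 {ω | M.avgLlr n ω ≤ c} ≤ ENNReal.ofReal β}) : M.optESS i α β ≤ n := by
  obtain ⟨hn1, c, h0, h1⟩ := hn
  have hmem : M.fixedSampleSizeTest n hn1 c ∈ M.testClass α β := by
    refine ⟨fun i => ae_of_all _ fun ω => ENat.natCast_ne_top n, ?_, ?_⟩
    · convert! h0 using 3
      simp [fixedSampleSizeTest]
    · convert! h1 using 3
      simp [fixedSampleSizeTest]
  refine (iInf₂_le _ hmem).trans ?_
  simp [fixedSampleSizeTest]

/-- The witness rules out the default value `sInf ∅ = 0`, so the minimum is attained and its test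
competes in the infimum. -/
lemma nStar_le_and_optESS_le {α β : ℝ} {n : ℕ}
    (hn : n ∈ {n : ℕ | 1 ≤ n ∧ ∃ c : ℝ, M.P 0 {ω | c < M.avgLlr n ω} ≤ ENNReal.ofReal α ∧
      M.P 1 {ω | M.avgLlr n ω ≤ c} ≤ ENNReal.ofReal β}) :
    M.nStar α β ≤ n ∧ ∀ i, M.optESS i α β ≤ M.nStar α β :=
  ⟨Nat.sInf_le hn, fun i => optESS_le_of_mem i (Nat.sInf_mem ⟨n, hn⟩)⟩

lemma mem_of_sampleSize {α β c : ℝ} {n : ℕ} (hn : 1 ≤ n)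
    (h0 : M.P 0 {ω | n * c ≤ M.logRatioSum 0 1 n ω} ≤ ENNReal.ofReal α)
    (h1 : M.P 1 {ω | M.logRatioSum 0 1 n ω ≤ n * c} ≤ ENNReal.ofReal β) :
    n ∈ {n : ℕ | 1 ≤ n ∧ ∃ c : ℝ, M.P 0 {ω | c < M.avgLlr n ω} ≤ ENNReal.ofReal α ∧
      M.P 1 {ω | M.avgLlr n ω ≤ c} ≤ ENNReal.ofReal β} := by
  have hn' : (0 : ℝ) < n := by exact_mod_cast hn
  refine ⟨hn, c, (measure_mono fun ω hω => ?_).trans h0, (measure_mono fun ω hω => ?_).trans h1⟩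
  · simp only [mem_ofPred, avgLlr, llrSum_eq, lt_div_iff₀ hn'] at hω ⊢
    linarith
  · simp only [mem_ofPred, avgLlr, llrSum_eq, div_le_iff₀ hn'] at hω ⊢
    linarith

/-- A squeeze: `(1 - η) W ≤ L ≤ N ≤ (1 + η) W` makes `N / L` tend to `1`, while `L'` is of order `V
+ 1 = o(W)`. -/
lemma tendsto_ratios {N : ℕ → ℕ} {L L' : ℕ → ℝ≥0∞} {V W : ℕ → ℝ} {C : ℝ}
    (hW : Tendsto W atTop atTop)
    (hVW : Tendsto (fun k => V k / W k) atTop (𝓝 0))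
    (hN : ∀ η : ℝ, 0 < η → ∀ᶠ k in atTop, (N k : ℝ) ≤ (1 + η) * W k ∧ L k ≤ N k)
    (hL : ∀ η ∈ Ioo (0 : ℝ) 1, ∀ᶠ k in atTop, ENNReal.ofReal ((1 - η) * W k) ≤ L k)
    (hL' : ∀ k, L' k ≤ ENNReal.ofReal (C * (V k + 1))) :
    Tendsto (fun k => L' k / (N k : ℝ≥0∞)) atTop (𝓝 0) ∧
      Tendsto (fun k => (N k : ℝ≥0∞) / L k) atTop (𝓝 1) := by
  constructor
  · have hlim : Tendsto (fun k => ENNReal.ofReal (2 * C * (V k / W k + 1 / W k))) atTop (𝓝 0) := by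
      have h1 := ((hVW.add (hW.const_div_atTop 1)).const_mul (2 * C))
      simpa using ENNReal.tendsto_ofReal h1
    refine tendsto_of_tendsto_of_tendsto_of_le_of_le' tendsto_const_nhds hlim
      (Eventually.of_forall fun _ => zero_le) ?_
    filter_upwards [hN 1 one_pos, hL (1 / 2) (by norm_num), hW.eventually_gt_atTop 0]
      with k hNk hLk hWk
    calc L' k / N k ≤ ENNReal.ofReal (C * (V k + 1)) / ENNReal.ofReal ((1 - 1 / 2) * W k) :=
          ENNReal.div_le_div (hL' k) (hLk.trans hNk.2)
      _ = _ := by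
        rw [← ENNReal.ofReal_div_of_pos (by linarith)]
        congr 1
        field_simp
        ring
  · have hlim : Tendsto (fun η : ℝ => ENNReal.ofReal ((1 + η) / (1 - η))) (𝓝[>] 0) (𝓝 1) := by
      have h1 : ContinuousAt (fun η : ℝ => (1 + η) / (1 - η)) 0 := by
        refine ContinuousAt.div (by fun_prop) (by fun_prop) (by norm_num)
      have h2 := ENNReal.tendsto_ofReal 
        (h1.tendsto.mono_left (nhdsWithin_le_nhds (s := Ioi 0)))
      simpa using h2
    have hlow : ∀ᶠ k in atTop, 1 ≤ (N k : ℝ≥0∞) / L k := by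
      filter_upwards [hN 1 one_pos, hL (1 / 2) (by norm_num), hW.eventually_gt_atTop 0]
        with k hNk hLk hWk
      have h0 : L k ≠ 0 := by
        refine (lt_of_lt_of_le ?_ hLk).ne'
        exact ENNReal.ofReal_pos.2 (by linarith)
      have h1 : L k ≠ ∞ := (hNk.2.trans_lt (ENNReal.natCast_lt_top _)).ne
      rw [ENNReal.le_div_iff_mul_le (Or.inl h0) (Or.inl h1), one_mul]
      exact hNk.2
    refine tendsto_order.2 ⟨fun x hx => ?_, fun x hx => ?_⟩
    · filter_upwards [hlow] with k hk using hx.trans_le hk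
    · obtain ⟨η, hη, hη'⟩ := ((hlim.eventually (gt_mem_nhds hx)).and
        (Ioo_mem_nhdsGT (zero_lt_one (α := ℝ)))).exists
      filter_upwards [hN η hη'.1, hL η hη', hW.eventually_gt_atTop 0] with k hNk hLk hWk
      refine lt_of_le_of_lt ?_ hη
      have h1 : 0 < 1 - η := by linarith [hη'.2]
      calc (N k : ℝ≥0∞) / L k
          ≤ ENNReal.ofReal ((1 + η) * W k) / ENNReal.ofReal ((1 - η) * W k) := by
            refine ENNReal.div_le_div ?_ hLk
            rw [← ENNReal.ofReal_natCast]
            exact ENNReal.ofReal_le_ofReal hNk.1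
        _ = _ := by
            rw [← ENNReal.ofReal_div_of_pos (by positivity)]
            congr 1
            field_simp

lemma tendsto_optESS_nStar_zero (h01 : M.law 0 ≪ M.law 1) (h10 : M.law 1 ≪ M.law 0)
    (hK0 : M.I₀ ≠ ∞) (hK0' : M.I₀ ≠ 0) (hK1 : M.I₁ ≠ ∞) (hK1' : M.I₁ ≠ 0)
    {α β : ℕ → ℝ} (hα : ∀ k, α k ∈ Ioo (0 : ℝ) 1) (hβ : ∀ k, β k ∈ Ioo (0 : ℝ) 1)
    (hα_lim : Tendsto α atTop (𝓝 0)) (hβ_lim : Tendsto β atTop (𝓝 0))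
    (h : Tendsto (fun k => |Real.log (α k)| / |Real.log (β k)|) atTop (𝓝 0)) :
    Tendsto (fun k => M.optESS 1 (α k) (β k) / (M.nStar (α k) (β k) : ℝ≥0∞)) atTop (𝓝 0) ∧
      Tendsto (fun k => (M.nStar (α k) (β k) : ℝ≥0∞) / M.optESS 0 (α k) (β k)) atTop (𝓝 1) := by
  obtain ⟨C, -, hub⟩ := exists_optESS_le h01 h10 hK0 hK0' hK1 hK1'
  have hpos := ENNReal.toReal_pos hK0' hK0
  refine tendsto_ratios ((tendsto_abs_log_atTop hβ hβ_lim).atTop_div_const hpos)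
    (V := fun k => |Real.log (α k)|) ?_ (fun η hη => ?_) (fun η hη => ?_)
    fun k => (hub _ _ (hα k) (hβ k)).2
  · have := h.mul_const M.I₀.toReal
    rw [zero_mul] at this
    refine this.congr fun k => ?_
    rw [div_div_eq_mul_div, div_mul_eq_mul_div]
  · obtain ⟨c, hc⟩ := eventually_exists_sampleSize h01 h10 hK0 hK0' hα hβ hβ_lim h hη
    filter_upwards [hc] with k ⟨n, hn1, hn, h0, h1⟩
    have hmem := nStar_le_and_optESS_le (mem_of_sampleSize hn1 h0 h1)
    exact ⟨le_trans (by exact_mod_cast hmem.1) hn, hmem.2 0⟩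
  · filter_upwards [eventually_le_lintegral_T h01 h10 (by decide) hK0 hK0' hα_lim hβ hβ_lim hη]
      with k hk
    exact le_iInf₂ fun τ hτ => hk τ hτ.2.1 hτ.2.2

lemma tendsto_optESS_nStar_top (h01 : M.law 0 ≪ M.law 1) (h10 : M.law 1 ≪ M.law 0)
    (hK0 : M.I₀ ≠ ∞) (hK0' : M.I₀ ≠ 0) (hK1 : M.I₁ ≠ ∞) (hK1' : M.I₁ ≠ 0)
    {α β : ℕ → ℝ} (hα : ∀ k, α k ∈ Ioo (0 : ℝ) 1) (hβ : ∀ k, β k ∈ Ioo (0 : ℝ) 1)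
    (hα_lim : Tendsto α atTop (𝓝 0)) (hβ_lim : Tendsto β atTop (𝓝 0))
    (h : Tendsto (fun k => |Real.log (α k)| / |Real.log (β k)|) atTop atTop) :
    Tendsto (fun k => M.optESS 0 (α k) (β k) / (M.nStar (α k) (β k) : ℝ≥0∞)) atTop (𝓝 0) ∧
      Tendsto (fun k => (M.nStar (α k) (β k) : ℝ≥0∞) / M.optESS 1 (α k) (β k)) atTop (𝓝 1) := by
  obtain ⟨C, -, hub⟩ := exists_optESS_le h01 h10 hK0 hK0' hK1 hK1'
  have hpos := ENNReal.toReal_pos hK1' hK1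
  have h' : Tendsto (fun k => |Real.log (β k)| / |Real.log (α k)|) atTop (𝓝 0) :=
    h.inv_tendsto_atTop.congr fun k => inv_div _ _
  refine tendsto_ratios ((tendsto_abs_log_atTop hα hα_lim).atTop_div_const hpos)
    (V := fun k => |Real.log (β k)|) ?_ (fun η hη => ?_) (fun η hη => ?_)
    fun k => (hub _ _ (hα k) (hβ k)).1
  · have := h'.mul_const M.I₁.toReal
    rw [zero_mul] at this
    refine this.congr fun k => ?_
    rw [div_div_eq_mul_div, div_mul_eq_mul_div]
  · obtain ⟨c, hc⟩ := eventually_exists_sampleSize h10 h01 hK1 hK1' hβ hα hα_lim h' hη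
    filter_upwards [hc] with k ⟨n, hn1, hn, h1, h0⟩
    -- Exchanging the hypotheses changes the sign of the walk, hence of the threshold, and exchanges
    -- the two errors.
    have hmem := nStar_le_and_optESS_le (mem_of_sampleSize (c := -c) hn1
      ((measure_mono fun ω hω => ?_).trans h0) ((measure_mono fun ω hω => ?_).trans h1))
    · exact ⟨le_trans (by exact_mod_cast hmem.1) hn, hmem.2 1⟩
    all_goals
      simp only [mem_ofPred, M.logRatioSum_swap 0 1] at hω ⊢
      linarith
  · filter_upwards [eventually_le_lintegral_T h10 h01 (by decide) hK1 hK1' hβ_lim hα hα_lim hη]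
      with k hk
    exact le_iInf₂ fun τ hτ => hk τ hτ.2.2 hτ.2.1

end BinaryTestingProblem

/-! ### Rate functions on the interval between the two means -/

/-- The properties of a Chernoff rate function `Φ` on the interval `[-A, B]` between the means of
the log-likelihood ratio under the two hypotheses. -/
structure IsChernoffRate (Φ : ℝ → ℝ) (A B : ℝ) : Prop where
  mono : Monotone Φ
  anti : Antitone fun c => Φ c - c
  left : Φ (-A) = 0
  right : Φ B = B
  pos : ∀ c, -A < c → 0 < Φ c
  gt : ∀ c, c < B → c < Φ c
  left_pos : 0 < A
  right_pos : 0 < B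

namespace IsChernoffRate

variable {Φ : ℝ → ℝ} {A B : ℝ}

/-- Exchanging the hypotheses replaces `c` by `-c` and the pair `Φ`, `Φ - c` by `Φ - c`, `Φ`. -/
lemma swap (h : IsChernoffRate Φ A B) : IsChernoffRate (fun c => Φ (-c) + c) B A where
  mono x y hxy := by
    have := h.anti (neg_le_neg hxy)
    simp only at this ⊢
    linarith
  anti x y hxy := by
    have := h.mono (neg_le_neg hxy)
    simp only
    linarith
  left := by simp [h.right]
  right := by simp [h.left]
  pos c hc := by linarith [h.gt (-c) (by linarith)]
  gt c hc := by linarith [h.pos (-c) (by linarith)]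
  left_pos := h.right_pos
  right_pos := h.left_pos

/-- Monotonicity of `Φ` and antitonicity of `Φ - c` put its increments between `0` and those of `c`,
so `Φ` is `1`-Lipschitz. -/
lemma continuous (h : IsChernoffRate Φ A B) : Continuous Φ := by
  refine (LipschitzWith.of_dist_le_mul (K := 1) fun x y => ?_).continuous
  rw [NNReal.coe_one, one_mul, Real.dist_eq, Real.dist_eq]
  rcases le_total x y with hxy | hxy
  · have h1 := h.mono hxy
    have h2 := h.anti hxy
    simp only at h2
    rw [abs_of_nonpos (by linarith), abs_of_nonpos (by linarith)]
    linarith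
  · have h1 := h.mono hxy
    have h2 := h.anti hxy
    simp only at h2
    rw [abs_of_nonneg (by linarith), abs_of_nonneg (by linarith)]
    linarith

/-- The denominator vanishes at `B`, so the intermediate value theorem is applied to `Φ c - u * (Φ c
- c)`, which goes from `-u * A` to `B`. -/
lemma exists_ratio_eq (h : IsChernoffRate Φ A B) {u : ℝ} (hu : 0 < u) :
    ∃ c ∈ Ioo (-A) B, Φ c / (Φ c - c) = u := by
  have hA := h.left_pos
  have hB := h.right_pos
  have hcont : ContinuousOn (fun c => Φ c - u * (Φ c - c)) (Icc (-A) B) := by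
    have := h.continuous
    fun_prop
  obtain ⟨c, hc, hc0⟩ := intermediate_value_Ioo (by linarith : -A ≤ B) hcont
    (show (0 : ℝ) ∈ _ by
      simp only [h.left, h.right, mem_Ioo]
      constructor <;> nlinarith)
  refine ⟨c, hc, ?_⟩
  have hgt := h.gt c hc.2
  rw [div_eq_iff (by linarith)]
  linarith

/-- The denominator is at most `A`, so the numerator tends to `0`; as `Φ` is monotone and positive
to the right of `-A`, this forces `c → -A`. -/
lemma tendsto_sub_of_ratio_tendsto_zero (h : IsChernoffRate Φ A B) {c : ℕ → ℝ}
    (hc : ∀ k, c k ∈ Ioo (-A) B)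
    (hlim : Tendsto (fun k => Φ (c k) / (Φ (c k) - c k)) atTop (𝓝 0)) :
    Tendsto (fun k => Φ (c k) - c k) atTop (𝓝 A) := by
  have hsub_pos : ∀ k, 0 < Φ (c k) - c k := fun k => by linarith [h.gt _ (hc k).2]
  have hsub_le : ∀ k, Φ (c k) - c k ≤ A := fun k => by
    have := h.anti (hc k).1.le
    simpa [h.left] using this
  have hΦ : Tendsto (fun k => Φ (c k)) atTop (𝓝 0) := by
    have h1 := hlim.mul_const A
    rw [zero_mul] at h1
    refine tendsto_of_tendsto_of_tendsto_of_le_of_le tendsto_const_nhds h1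
      (fun k => (h.pos _ (hc k).1).le) fun k => ?_
    calc Φ (c k) = Φ (c k) / (Φ (c k) - c k) * (Φ (c k) - c k) :=
          (div_mul_cancel₀ _ (hsub_pos k).ne').symm
      _ ≤ _ := mul_le_mul_of_nonneg_left (hsub_le k)
          (div_nonneg (h.pos _ (hc k).1).le (hsub_pos k).le)
  have hcA : Tendsto c atTop (𝓝 (-A)) := by
    refine tendsto_order.2 ⟨fun x hx => Eventually.of_forall fun k => hx.trans (hc k).1,
      fun x hx => ?_⟩
    filter_upwards [hΦ.eventually (gt_mem_nhds (h.pos x hx))] with k hk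
    exact h.mono.reflect_lt hk
  simpa using hΦ.sub hcA

lemma tendsto_of_ratio_tendsto_atTop (h : IsChernoffRate Φ A B) {c : ℕ → ℝ}
    (hc : ∀ k, c k ∈ Ioo (-A) B)
    (hlim : Tendsto (fun k => Φ (c k) / (Φ (c k) - c k)) atTop atTop) :
    Tendsto (fun k => Φ (c k)) atTop (𝓝 B) := by
  have := h.swap.tendsto_sub_of_ratio_tendsto_zero (c := fun k => -c k)
    (fun k => ⟨by linarith [(hc k).2], by linarith [(hc k).1]⟩) ?_
  · simpa using this
  · refine hlim.inv_tendsto_atTop.congr fun k => ?_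
    simp only [Pi.inv_apply, inv_div, neg_neg, sub_neg_eq_add, neg_add_cancel_right]
    rfl

end IsChernoffRate

/-! ### Identification of `ψ₀`, `ψ₁` and the inverse of `g` -/

namespace BinaryTestingProblem

variable {𝓧 : Type*} [MeasurableSpace 𝓧] {M : BinaryTestingProblem 𝓧} {i j : Fin 2}

/-- The Legendre transform on `[0, 1]` of the cumulant generating function of `log (f 1 / f 0)`
under hypothesis `0`. -/
noncomputable def chernoffRate (M : BinaryTestingProblem 𝓧) (c : ℝ) : ℝ :=
  ⨆ s : Icc (0 : ℝ) 1, ((s : ℝ) * c - Real.log (M.momentGen 0 1 s).toReal)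

lemma neg_mul_le_log_momentGen (hij : M.law i ≪ M.law j) (hji : M.law j ≪ M.law i)
    (hK : InformationTheory.klDiv (M.law i) (M.law j) ≠ ∞) (s : ℝ) :
    ((-(s * (InformationTheory.klDiv (M.law i) (M.law j)).toReal) : ℝ) : EReal) ≤
      ENNReal.log (M.momentGen i j s) := by
  refine le_trans (le_of_eq ?_) (ENNReal.log_monotone (le_momentGen hij hji hK s))
  rw [ENNReal.log_ofReal_of_pos (Real.exp_pos _), Real.log_exp]

lemma momentGen_ne_zero (hij : M.law i ≪ M.law j) (hji : M.law j ≪ M.law i)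
    (hK : InformationTheory.klDiv (M.law i) (M.law j) ≠ ∞) (s : ℝ) : M.momentGen i j s ≠ 0 :=
  ((ENNReal.ofReal_pos.2 (Real.exp_pos _)).trans_le (le_momentGen hij hji hK s)).ne'

lemma log_momentGen_eq (hij : M.law i ≪ M.law j) (hji : M.law j ≪ M.law i)
    (hK : InformationTheory.klDiv (M.law i) (M.law j) ≠ ∞) {s : ℝ} (hs : s ∈ Icc (0 : ℝ) 1) :
    ENNReal.log (M.momentGen i j s) = (Real.log (M.momentGen i j s).toReal : ℝ) :=
  ENNReal.log_pos_real (momentGen_ne_zero hij hji hK s)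
    ((momentGen_le_one hij hji hs.1 hs.2).trans_lt ENNReal.one_lt_top).ne

lemma log_momentGen_ge (h01 : M.law 0 ≪ M.law 1) (h10 : M.law 1 ≪ M.law 0) (hK0 : M.I₀ ≠ ∞)
    {s : ℝ} (hs : s ∈ Icc (0 : ℝ) 1) :
    -(s * M.I₀.toReal) ≤ Real.log (M.momentGen 0 1 s).toReal := by
  have h := neg_mul_le_log_momentGen h01 h10 hK0 s
  rwa [log_momentGen_eq h01 h10 hK0 hs, EReal.coe_le_coe_iff] at h

/-- Jensen under hypothesis `1`, carried over by `s ↦ 1 - s`: a supporting line through the zero at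
`s = 1`. -/
lemma log_momentGen_ge' (h01 : M.law 0 ≪ M.law 1) (h10 : M.law 1 ≪ M.law 0) (hK1 : M.I₁ ≠ ∞)
    (s : ℝ) : (((s - 1) * M.I₁.toReal : ℝ) : EReal) ≤ ENNReal.log (M.momentGen 0 1 s) := by
  have h := neg_mul_le_log_momentGen h10 h01 hK1 (1 - s)
  rw [momentGen_swap h01 h10, sub_sub_cancel] at h
  convert! h using 2
  change _ = -((1 - s) * M.I₁.toReal)
  ring

lemma bddAbove_chernoffRate (h01 : M.law 0 ≪ M.law 1) (h10 : M.law 1 ≪ M.law 0)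
    (hK0 : M.I₀ ≠ ∞) (c : ℝ) : BddAbove (range fun s : Icc (0 : ℝ) 1 =>
      ((s : ℝ) * c - Real.log (M.momentGen 0 1 s).toReal)) := by
  refine ⟨|c| + M.I₀.toReal, ?_⟩
  rintro _ ⟨⟨s, hs⟩, rfl⟩
  have h := log_momentGen_ge h01 h10 hK0 hs
  have h1 : s * c ≤ |c| := by nlinarith [le_abs_self c, abs_nonneg c, hs.1, hs.2]
  have h2 : 0 ≤ M.I₀.toReal := ENNReal.toReal_nonneg
  have h3 : s * M.I₀.toReal ≤ M.I₀.toReal := mul_le_of_le_one_left h2 hs.2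
  simp only
  linarith

lemma le_chernoffRate (h01 : M.law 0 ≪ M.law 1) (h10 : M.law 1 ≪ M.law 0) (hK0 : M.I₀ ≠ ∞)
    {s : ℝ} (hs : s ∈ Icc (0 : ℝ) 1) (c : ℝ) :
    s * c - Real.log (M.momentGen 0 1 s).toReal ≤ M.chernoffRate c :=
  le_ciSup (bddAbove_chernoffRate h01 h10 hK0 c) ⟨s, hs⟩

lemma chernoffRate_le {c x : ℝ} (h : ∀ s ∈ Icc (0 : ℝ) 1,
    s * c - Real.log (M.momentGen 0 1 s).toReal ≤ x) : M.chernoffRate c ≤ x :=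
  have : Nonempty (Icc (0 : ℝ) 1) := ⟨⟨0, by simp⟩⟩
  ciSup_le fun s => h s s.2

lemma chernoffRate_nonneg (h01 : M.law 0 ≪ M.law 1) (h10 : M.law 1 ≪ M.law 0)
    (hK0 : M.I₀ ≠ ∞) (c : ℝ) : 0 ≤ M.chernoffRate c := by
  simpa [momentGen_zero] using le_chernoffRate h01 h10 hK0 (s := 0) (by simp) c

lemma self_le_chernoffRate (h01 : M.law 0 ≪ M.law 1) (h10 : M.law 1 ≪ M.law 0)
    (hK0 : M.I₀ ≠ ∞) (c : ℝ) : c ≤ M.chernoffRate c := by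
  simpa [momentGen_one h01 h10] using le_chernoffRate h01 h10 hK0 (s := 1) (by simp) c

/-- Slopes in `[0, 1]` give both monotonicities, the two Jensen lines give the endpoint values, and
the strict Chernoff bounds above each mean give strict positivity. -/
lemma isChernoffRate (h01 : M.law 0 ≪ M.law 1) (h10 : M.law 1 ≪ M.law 0)
    (hK0 : M.I₀ ≠ ∞) (hK0' : M.I₀ ≠ 0) (hK1 : M.I₁ ≠ ∞) (hK1' : M.I₁ ≠ 0) :
    IsChernoffRate M.chernoffRate M.I₀.toReal M.I₁.toReal where
  mono x y hxy := by
    refine chernoffRate_le fun s hs => le_trans ?_ (le_chernoffRate h01 h10 hK0 hs y)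
    have := mul_le_mul_of_nonneg_left hxy hs.1
    linarith
  anti x y hxy := by
    simp only
    rw [sub_le_iff_le_add]
    refine chernoffRate_le fun s hs => ?_
    have h1 := le_chernoffRate h01 h10 hK0 hs x
    have h2 := mul_le_mul_of_nonneg_left hxy (sub_nonneg.2 hs.2)
    linarith
  left := by
    refine le_antisymm (chernoffRate_le fun s hs => ?_) (chernoffRate_nonneg h01 h10 hK0 _)
    have := log_momentGen_ge h01 h10 hK0 hs
    linarith
  right := by
    refine le_antisymm (chernoffRate_le fun s hs => ?_) (self_le_chernoffRate h01 h10 hK0 _)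
    have := log_momentGen_ge' h01 h10 hK1 s
    rw [log_momentGen_eq h01 h10 hK0 hs, EReal.coe_le_coe_iff] at this
    linarith
  pos c hc := by
    obtain ⟨s, hs, hlt⟩ := exists_momentGen_lt h01 h10 hK0 hc
    have hs' : s ∈ Icc (0 : ℝ) 1 := ⟨hs.1.le, hs.2.le⟩
    have h1 := le_chernoffRate h01 h10 hK0 hs' c
    have h2 := ENNReal.log_strictMono hlt
    rw [log_momentGen_eq h01 h10 hK0 hs', ENNReal.log_ofReal_of_pos (Real.exp_pos _),
      Real.log_exp, EReal.coe_lt_coe_iff] at h2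
    linarith
  gt c hc := by
    obtain ⟨s, hs, hlt⟩ := exists_momentGen_lt h10 h01 hK1 (c := -c) (neg_lt_neg hc)
    have hs' : 1 - s ∈ Icc (0 : ℝ) 1 := ⟨by linarith [hs.2], by linarith [hs.1]⟩
    rw [momentGen_swap h01 h10] at hlt
    have h1 := le_chernoffRate h01 h10 hK0 hs' c
    have h2 := ENNReal.log_strictMono hlt
    rw [log_momentGen_eq h01 h10 hK0 hs', ENNReal.log_ofReal_of_pos (Real.exp_pos _),
      Real.log_exp, EReal.coe_lt_coe_iff] at h2
    linarith
  left_pos := ENNReal.toReal_pos hK0' hK0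
  right_pos := ENNReal.toReal_pos hK1' hK1

lemma coe_chernoffRate_le {c x : ℝ} {y : EReal} (h : ∀ s ∈ Icc (0 : ℝ) 1,
    ((s * c - Real.log (M.momentGen 0 1 s).toReal - x : ℝ) : EReal) ≤ y) :
    ((M.chernoffRate c - x : ℝ) : EReal) ≤ y := by
  induction y with
  | bot =>
    have := h 0 (by simp)
    simp only [le_bot_iff] at this
    exact absurd this (EReal.coe_ne_bot _)
  | top => exact le_top
  | coe y =>
    rw [EReal.coe_le_coe_iff, sub_le_iff_le_add]
    refine chernoffRate_le fun s hs => ?_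
    have := h s hs
    rw [EReal.coe_le_coe_iff] at this
    linarith

lemma coe_sub_log_le {A : ℝ≥0∞} {x y z : ℝ} (h : (x : EReal) ≤ ENNReal.log A) (hz : y - x ≤ z) :
    (y : EReal) - ENNReal.log A ≤ (z : ℝ) := by
  calc (y : EReal) - ENNReal.log A ≤ (y : EReal) - (x : EReal) := EReal.sub_le_sub le_rfl h
    _ = ((y - x : ℝ) : EReal) := (EReal.coe_sub _ _).symm
    _ ≤ _ := EReal.coe_le_coe_iff.2 hz

/-- Exponents `s > 1` add nothing: by the Jensen line through `s = 1` their term is at most `c + (s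
- 1) * (c - I₁) ≤ c`, the value at `s = 1`. -/
lemma ψ₀_eq (h01 : M.law 0 ≪ M.law 1) (h10 : M.law 1 ≪ M.law 0) (hK0 : M.I₀ ≠ ∞)
    (hK1 : M.I₁ ≠ ∞) {c : ℝ} (hc : c ≤ M.I₁.toReal) : M.ψ₀ c = (M.chernoffRate c : ℝ) := by
  simp only [ψ₀, ← momentGen_eq h01 h10]
  refine le_antisymm (iSup₂_le fun s hs => ?_) ?_
  · rcases le_or_gt s 1 with h1 | h1
    · refine coe_sub_log_le (log_momentGen_eq h01 h10 hK0 ⟨hs, h1⟩).ge ?_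
      exact le_chernoffRate h01 h10 hK0 ⟨hs, h1⟩ c
    · refine coe_sub_log_le (log_momentGen_ge' h01 h10 hK1 s) ?_
      have := self_le_chernoffRate h01 h10 hK0 c
      nlinarith
  · rw [← sub_zero (M.chernoffRate c)]
    refine coe_chernoffRate_le fun s hs => ?_
    refine le_trans (le_of_eq ?_) (le_iSup₂ (f := fun (θ : ℝ) (_ : 0 ≤ θ) =>
      ((θ * c : ℝ) : EReal) - ENNReal.log (M.momentGen 0 1 θ)) s hs.1)
    rw [log_momentGen_eq h01 h10 hK0 hs, sub_zero, EReal.coe_sub]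

/-- Substituting `s = 1 + θ` shifts the Legendre transform by `-c`. For `s < 0` the Jensen line
through `s = 0` bounds the term by `s * (c + I₀) - c ≤ -c`, the value at `s = 0`. -/
lemma ψ₁_eq (h01 : M.law 0 ≪ M.law 1) (h10 : M.law 1 ≪ M.law 0) (hK0 : M.I₀ ≠ ∞)
    {c : ℝ} (hc : -M.I₀.toReal ≤ c) : M.ψ₁ c = (M.chernoffRate c - c : ℝ) := by
  have hA : ∀ s : ℝ, ∫⁻ x, (M.f 0 x : ℝ≥0∞) ^ (-s) * (M.f 1 x : ℝ≥0∞) ^ (1 + s) ∂M.ν =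
      M.momentGen 0 1 (1 + s) := fun s => by
    rw [momentGen_eq h01 h10]
    simp [mul_comm]
  simp only [ψ₁, hA]
  refine le_antisymm (iSup₂_le fun s hs => ?_) ?_
  · rcases le_or_gt 0 (1 + s) with h1 | h1
    · have hs' : 1 + s ∈ Icc (0 : ℝ) 1 := ⟨h1, by linarith⟩
      refine coe_sub_log_le (log_momentGen_eq h01 h10 hK0 hs').ge ?_
      have := le_chernoffRate h01 h10 hK0 hs' c
      linarith
    · refine coe_sub_log_le (neg_mul_le_log_momentGen h01 h10 hK0 (1 + s)) ?_
      have := chernoffRate_nonneg h01 h10 hK0 c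
      change s * c - -((1 + s) * M.I₀.toReal) ≤ _
      nlinarith
  · refine coe_chernoffRate_le fun s hs => ?_
    refine le_trans (le_of_eq ?_) (le_iSup₂ (f := fun (θ : ℝ) (_ : θ ≤ 0) =>
      ((θ * c : ℝ) : EReal) - ENNReal.log (M.momentGen 0 1 (1 + θ))) (s - 1) (by linarith [hs.2]))
    rw [add_sub_cancel, log_momentGen_eq h01 h10 hK0 hs, ← EReal.coe_sub]
    congr 1
    ring

lemma g_eq (h01 : M.law 0 ≪ M.law 1) (h10 : M.law 1 ≪ M.law 0) (hK0 : M.I₀ ≠ ∞)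
    (hK1 : M.I₁ ≠ ∞) {c : ℝ} (hc : c ∈ Ioo (-M.I₀.toReal) M.I₁.toReal) :
    M.g c = M.chernoffRate c / (M.chernoffRate c - c) := by
  rw [g, ψ₀_eq h01 h10 hK0 hK1 hc.2.le, ψ₁_eq h01 h10 hK0 hc.1.le, EReal.toReal_coe,
    EReal.toReal_coe]

/-- Surjectivity of `g` suffices: the limits hold for any choice of preimages. -/
lemma gInv_spec (h01 : M.law 0 ≪ M.law 1) (h10 : M.law 1 ≪ M.law 0)
    (hK0 : M.I₀ ≠ ∞) (hK0' : M.I₀ ≠ 0) (hK1 : M.I₁ ≠ ∞) (hK1' : M.I₁ ≠ 0) {u : ℝ} (hu : 0 < u) :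
    M.gInv u ∈ Ioo (-M.I₀.toReal) M.I₁.toReal ∧
      M.chernoffRate (M.gInv u) / (M.chernoffRate (M.gInv u) - M.gInv u) = u := by
  obtain ⟨c, hc, hcu⟩ := (isChernoffRate h01 h10 hK0 hK0' hK1 hK1').exists_ratio_eq hu
  have hex : ∃ c ∈ Ioo (-M.I₀.toReal) M.I₁.toReal, M.g c = u :=
    ⟨c, hc, by rw [g_eq h01 h10 hK0 hK1 hc, hcu]⟩
  have hmem : M.gInv u ∈ Ioo (-M.I₀.toReal) M.I₁.toReal := Function.invFunOn_mem hex
  refine ⟨hmem, ?_⟩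
  rw [← g_eq h01 h10 hK0 hK1 hmem]
  exact Function.invFunOn_eq hex

end BinaryTestingProblem

theorem mainTheorem8 {𝓧 : Type*} [MeasurableSpace 𝓧] (M : BinaryTestingProblem 𝓧)
    (hI₀_pos : 0 < M.I₀) (hI₀_fin : M.I₀ < ∞) (hI₁_pos : 0 < M.I₁) (hI₁_fin : M.I₁ < ∞)
    (α β : ℕ → ℝ) (hα : ∀ k, α k ∈ Ioo (0 : ℝ) 1) (hβ : ∀ k, β k ∈ Ioo (0 : ℝ) 1)
    (hα_lim : Tendsto α atTop (𝓝 0)) (hβ_lim : Tendsto β atTop (𝓝 0)) :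
    (Tendsto (fun k => |Real.log (α k)| / |Real.log (β k)|) atTop (𝓝 0) →
      Tendsto (fun k => M.h₁ (α k) (β k)) atTop (𝓝 M.I₀.toReal) ∧
      Tendsto (fun k => M.optESS 1 (α k) (β k) / (M.nStar (α k) (β k) : ℝ≥0∞)) atTop (𝓝 0) ∧
      Tendsto (fun k => (M.nStar (α k) (β k) : ℝ≥0∞) / M.optESS 0 (α k) (β k)) atTop (𝓝 1)) ∧
    (Tendsto (fun k => |Real.log (α k)| / |Real.log (β k)|) atTop atTop →
      Tendsto (fun k => M.h₀ (α k) (β k)) atTop (𝓝 M.I₁.toReal) ∧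
      Tendsto (fun k => M.optESS 0 (α k) (β k) / (M.nStar (α k) (β k) : ℝ≥0∞)) atTop (𝓝 0) ∧
      Tendsto (fun k => (M.nStar (α k) (β k) : ℝ≥0∞) / M.optESS 1 (α k) (β k)) atTop (𝓝 1)) := by
  obtain ⟨h01, -⟩ := InformationTheory.klDiv_ne_top_iff.1 hI₀_fin.ne
  obtain ⟨h10, -⟩ := InformationTheory.klDiv_ne_top_iff.1 hI₁_fin.ne
  have hu : ∀ k, 0 < |Real.log (α k)| / |Real.log (β k)| := fun k =>
    div_pos (abs_pos.2 (Real.log_neg (hα k).1 (hα k).2).ne)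
      (abs_pos.2 (Real.log_neg (hβ k).1 (hβ k).2).ne)
  have hspec := fun k => BinaryTestingProblem.gInv_spec h01 h10 hI₀_fin.ne hI₀_pos.ne'
    hI₁_fin.ne hI₁_pos.ne' (hu k)
  have hrate := BinaryTestingProblem.isChernoffRate h01 h10 hI₀_fin.ne hI₀_pos.ne'
    hI₁_fin.ne hI₁_pos.ne'
  refine ⟨fun h => ⟨?_, BinaryTestingProblem.tendsto_optESS_nStar_zero h01 h10 hI₀_fin.ne
    hI₀_pos.ne' hI₁_fin.ne hI₁_pos.ne' hα hβ hα_lim hβ_lim h⟩,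
    fun h => ⟨?_, BinaryTestingProblem.tendsto_optESS_nStar_top h01 h10 hI₀_fin.ne
    hI₀_pos.ne' hI₁_fin.ne hI₁_pos.ne' hα hβ hα_lim hβ_lim h⟩⟩
  · refine (hrate.tendsto_sub_of_ratio_tendsto_zero (fun k => (hspec k).1) ?_).congr fun k => ?_
    · exact h.congr fun k => (hspec k).2.symm
    · rw [BinaryTestingProblem.h₁,
        BinaryTestingProblem.ψ₁_eq h01 h10 hI₀_fin.ne (hspec k).1.1.le, EReal.toReal_coe]
  · refine (hrate.tendsto_of_ratio_tendsto_atTop (fun k => (hspec k).1) ?_).congr fun k => ?_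
    · exact h.congr fun k => (hspec k).2.symm
    · rw [BinaryTestingProblem.h₀,
        BinaryTestingProblem.ψ₀_eq h01 h10 hI₀_fin.ne hI₁_fin.ne (hspec k).1.2.le,
        EReal.toReal_coe]
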